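/- **Model.** A network is a finite connected simple graph $G=(V,E)$ with $n=|V|$ vertices, equipped with pairwise distinct identifiers in $\mathbb{N}$ of $O(\log n)$ bits, i.e. of at most $c\cdot\ell(n)$ bits, where $c$ is a fixed constant and $\ell(n)$ is the length of the binary expansion of $n$. A certificate assignment gives each vertex a finite bit string. The view at distance $k$ of a vertex $v$ consists of the vertices at distance at most $k$ from $v$, with their identifiers and certificates, and of the edges between these vertices except those joining two vertices at distance exactly $k$ from $v$. A graph property $P$ has a local certification of size $s:\mathbb{N}\to\mathbb{N}$ with verification radius $k$ if there is a verification algorithm, that is, a function mapping every view at distance $k$ to accept or reject, such that for every network $G$ on $n$ vertices and every admissible choice of identifiers: * if $G$ satisfies $P$, then for some assignment of certificates of at most $s(n)$ bits every vertex accepts; * if $G$ does not satisfy $P$, then for every assignment of certificates at least one vertex rejects. **Theorem.** Let $k\ge 2$, and let $c$ be the constant in the bound on the identifiers. There is a function $s$ with $s(n)=O(n^{3/2}\log^2 n)$ (where the implied constant may depend on $k$ and $c$) such that for every finite graph $H$ on at most $4k-1$ vertices both of the following properties have a local certification of size $s$ with verification radius $k$: 1. $G$ does not contain $H$ as an induced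 subgraph; 2. $G$ does not contain $H$ as a (not necessarily induced) subgraph. -/

import Mathlib

universe u v

/-- What a node sees of the network. As identifiers are unique, nodes are named by their identifiers:
`center` is the observing node, `nodes` lists the visible nodes together with their certificates,
and `edges` lists the visible edges (in both orientations). -/
structure LocalView where
  center : ℕ
  nodes : Set (ℕ × List Bool)
  edges : Set (ℕ × ℕ)

/-- The view at distance `k` of the node `x`: the nodes at distance at most `k` from `x`, their
identifiers and certificates, and the edges between these nodes except those joining two nodes
at distance exactly `k`. -/
def localView {V : Type u} (G : SimpleGraph V) (ident : V → ℕ) (cert : V → List Bool)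
    (k : ℕ) (x : V) : LocalView where
  center := ident x
  nodes := {p | ∃ y : V, G.edist x y ≤ k ∧ p = (ident y, cert y)}
  edges := {p | ∃ y z : V, G.Adj y z ∧ G.edist x y ≤ k ∧ G.edist x z ≤ k ∧
    ¬ (G.edist x y = k ∧ G.edist x z = k) ∧ p = (ident y, ident z)}

/-- Unique identifiers on `O(log n)` bits, where `n` is the number of vertices: the identifiers are
pairwise distinct, and each one is written on at most `c` times as many bits as `n`
(`Nat.size m` is the length of the binary expansion of `m`). -/
def IsIdentAssignment (c : ℕ) {V : Type u} [Fintype V] (ident : V → ℕ) : Prop :=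
  Function.Injective ident ∧ ∀ x, (ident x).size ≤ c * (Fintype.card V).size

/-- The property `P` of networks (finite connected graphs) has a local certification with
verification radius `k` and certificates of at most `s n` bits on `n`-vertex networks, when the
identifiers have at most `c * Nat.size n` bits. The verification algorithm is an arbitrary function
of the view (`true` means accept); in particular it is not told `n`, and the certificates it may
face on an instance that violates `P` are arbitrary. -/
def HasLocalCertification (c k : ℕ) (s : ℕ → ℕ)
    (P : ∀ (V : Type u) [Fintype V], SimpleGraph V → Prop) : Prop :=
  ∃ verify : LocalView → Bool,
    ∀ (V : Type u) [Fintype V] (G : SimpleGraph V), G.Connected →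
    ∀ ident : V → ℕ, IsIdentAssignment c ident →
      (P V G → ∃ cert : V → List Bool, (∀ x, (cert x).length ≤ s (Fintype.card V)) ∧
        ∀ x, verify (localView G ident cert k x) = true) ∧
      (¬ P V G → ∀ cert : V → List Bool,
        ∃ x, verify (localView G ident cert k x) = false)

/-! ### Self-delimiting binary codes -/

/-- A binary code whose codewords can be read off from the left of any bit string. -/
def SelfDelimiting {α : Type*} (code : α → List Bool) : Prop :=
  ∀ a b s t, code a ++ s = code b ++ t → a = b ∧ s = t

theorem SelfDelimiting.injective {α : Type*} {code : α → List Bool} (h : SelfDelimiting code) :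
    Function.Injective code := fun a b hab => (h a b [] [] (by rw [hab])).1

theorem SelfDelimiting.comp {α β : Type*} {code : β → List Bool} (h : SelfDelimiting code)
    {f : α → β} (hf : Function.Injective f) : SelfDelimiting (code ∘ f) :=
  fun _ _ _ _ hab => ⟨hf (h _ _ _ _ hab).1, (h _ _ _ _ hab).2⟩

/-- The code of a list: every element is announced by the bit `true`, the end by `false`. -/
def listCode {α : Type*} (code : α → List Bool) : List α → List Bool
  | [] => [false]
  | a :: l => true :: (code a ++ listCode code l)

theorem SelfDelimiting.list {α : Type*} {code : α → List Bool} (h : SelfDelimiting code) :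
    SelfDelimiting (listCode code) := by
  intro a
  induction a with
  | nil =>
    intro b s t hb
    cases b with
    | nil => simpa [listCode] using hb
    | cons b l => simp [listCode] at hb
  | cons a l ih =>
    intro b s t hb
    cases b with
    | nil => simp [listCode] at hb
    | cons b l' =>
      simp only [listCode, List.cons_append, List.cons.injEq, true_and, List.append_assoc] at hb
      obtain ⟨rfl, h2⟩ := h _ _ _ _ hb
      obtain ⟨rfl, h3⟩ := ih _ _ _ h2
      exact ⟨rfl, h3⟩

theorem length_listCode_le {α : Type*} {code : α → List Bool} {l : List α} {B : ℕ}
    (h : ∀ a ∈ l, (code a).length ≤ B) : (listCode code l).length ≤ l.length * (B + 1) + 1 := by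
  induction l with
  | nil => simp [listCode]
  | cons a l ih =>
    have h1 := h a (by simp)
    have h2 := ih fun b hb => h b (by simp [hb])
    simp only [listCode, List.length_cons, List.length_append]
    nlinarith

/-- The concatenation of the codes of the two components. -/
def prodCode {α β : Type*} (code : α → List Bool) (code' : β → List Bool) (p : α × β) :
    List Bool := code p.1 ++ code' p.2

theorem SelfDelimiting.prod {α β : Type*} {code : α → List Bool} {code' : β → List Bool}
    (h : SelfDelimiting code) (h' : SelfDelimiting code') :
    SelfDelimiting (prodCode code code') := by
  rintro ⟨a, b⟩ ⟨a', b'⟩ s t hab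
  simp only [prodCode, List.append_assoc] at hab
  obtain ⟨rfl, h2⟩ := h _ _ _ _ hab
  obtain ⟨rfl, h3⟩ := h' _ _ _ _ h2
  exact ⟨rfl, h3⟩

theorem length_prodCode {α β : Type*} (code : α → List Bool) (code' : β → List Bool) (p : α × β) :
    (prodCode code code' p).length = (code p.1).length + (code' p.2).length := by
  simp [prodCode]

/-- The code of a natural number, read off from its binary expansion. -/
def natCode (m : ℕ) : List Bool := listCode (fun b => [b]) m.bits

theorem selfDelimiting_natCode : SelfDelimiting natCode := by
  refine SelfDelimiting.comp (f := Nat.bits) (SelfDelimiting.list ?_) ?_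
  · intro a b s t h
    simpa using h
  · intro a b h
    rw [← Nat.digits_inj_iff (b := 2), Nat.digits_two_eq_bits, Nat.digits_two_eq_bits, h]

theorem length_natCode_le (m : ℕ) : (natCode m).length ≤ 2 * m.size + 1 := by
  have := length_listCode_le (code := fun b : Bool => [b]) (l := m.bits) (B := 1) (by simp)
  rw [Nat.size_eq_bits_len] at this
  unfold natCode
  omega

/-- What all the nodes agree on: a table `(identifier, label, level, depth)` of the nodes, a list of
edges, and a list of pairs of nodes whose adjacency is declared known. -/
structure GlobalMap where
  vertices : List (ℕ × ℕ × ℕ × ℕ)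
  edges : List (ℕ × ℕ)
  known : List (ℕ × ℕ)

instance : Inhabited GlobalMap := ⟨⟨[], [], []⟩⟩

/-- The code of a global map together with a list of edges. -/
def certificateCode : GlobalMap × List (ℕ × ℕ) → List Bool :=
  prodCode (listCode (prodCode natCode (prodCode natCode (prodCode natCode natCode))))
    (prodCode (listCode (prodCode natCode natCode))
      (prodCode (listCode (prodCode natCode natCode)) (listCode (prodCode natCode natCode)))) ∘
    fun d => (d.1.vertices, d.1.edges, d.1.known, d.2)

theorem certificateCode_injective : Function.Injective certificateCode := by
  have h := selfDelimiting_natCode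
  refine ((h.prod (h.prod (h.prod h))).list.prod
    ((h.prod h).list.prod ((h.prod h).list.prod (h.prod h).list))).injective.comp ?_
  rintro ⟨⟨a, b, c⟩, d⟩ ⟨⟨a', b', c'⟩, d'⟩ h
  simp_all

/-- The contents of a certificate. -/
noncomputable def decodeCertificate : List Bool → GlobalMap × List (ℕ × ℕ) :=
  Function.invFun certificateCode

theorem decodeCertificate_code (d : GlobalMap × List (ℕ × ℕ)) :
    decodeCertificate (certificateCode d) = d :=
  Function.leftInverse_invFun certificateCode_injective d

theorem length_certificateCode_le (g : GlobalMap) (l : List (ℕ × ℕ)) (B : ℕ)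
    (hv : ∀ t ∈ g.vertices, t.1.size ≤ B ∧ t.2.1.size ≤ B ∧ t.2.2.1.size ≤ B ∧ t.2.2.2.size ≤ B)
    (he : ∀ t ∈ g.edges, t.1.size ≤ B ∧ t.2.size ≤ B)
    (hk : ∀ t ∈ g.known, t.1.size ≤ B ∧ t.2.size ≤ B)
    (hl : ∀ t ∈ l, t.1.size ≤ B ∧ t.2.size ≤ B) :
    (certificateCode (g, l)).length ≤
      (g.vertices.length + g.edges.length + g.known.length + l.length) * (8 * B + 5) + 4 := by
  have key : ∀ l : List (ℕ × ℕ), (∀ t ∈ l, t.1.size ≤ B ∧ t.2.size ≤ B) →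
      (listCode (prodCode natCode natCode) l).length ≤ l.length * (8 * B + 5) + 1 := by
    intro l hl
    refine length_listCode_le fun t ht => ?_
    have := hl t ht
    have h1 := length_natCode_le t.1
    have h2 := length_natCode_le t.2
    rw [length_prodCode]
    omega
  have h1 : (listCode (prodCode natCode (prodCode natCode (prodCode natCode natCode)))
      g.vertices).length ≤ g.vertices.length * (8 * B + 5) + 1 := by
    refine length_listCode_le fun t ht => ?_
    have := hv t ht
    have h1 := length_natCode_le t.1
    have h2 := length_natCode_le t.2.1
    have h3 := length_natCode_le t.2.2.1
    have h4 := length_natCode_le t.2.2.2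
    simp only [length_prodCode]
    omega
  have h2 := key _ he
  have h3 := key _ hk
  have h4 := key _ hl
  simp only [certificateCode, Function.comp, length_prodCode]
  nlinarith

/-! ### Colourings in which large neighbourhoods see all the colours -/

theorem two_mul_pow_le_succ_pow (p : ℕ) : 2 * p ^ (p + 1) ≤ (p + 1) ^ (p + 1) := by
  rcases Nat.eq_zero_or_pos p with rfl | hp
  · simp
  have h : p ^ p + p * p ^ (p - 1) ≤ (p + 1) ^ p := by
    have := pow_add_mul_le_add_pow_of_sq_nonneg (R := ℕ) (a := p) (b := 1) (by simp) (by simp)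
      (by simp) (by simp) p
    simpa using this
  have h2 : p * p ^ (p - 1) = p ^ p := by
    rw [← pow_succ', Nat.sub_add_cancel hp]
  rw [h2] at h
  calc 2 * p ^ (p + 1) = (p ^ p + p ^ p) * p := by ring
    _ ≤ (p + 1) ^ p * (p + 1) := Nat.mul_le_mul h (Nat.le_succ p)
    _ = _ := by ring

theorem two_pow_mul_pow_lt (p m d N : ℕ) (hN : N < 2 ^ m) (hd : (p + 1) * m ≤ d) :
    N * p ^ d < (p + 1) ^ d := by
  have h1 : 2 ^ m * p ^ ((p + 1) * m) ≤ (p + 1) ^ ((p + 1) * m) := by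
    rw [pow_mul, pow_mul, ← mul_pow]
    exact Nat.pow_le_pow_left (two_mul_pow_le_succ_pow p) m
  obtain ⟨e, rfl⟩ := Nat.exists_eq_add_of_le hd
  calc N * p ^ ((p + 1) * m + e) ≤ N * p ^ ((p + 1) * m) * (p + 1) ^ e := by
        rw [pow_add, ← mul_assoc]
        exact Nat.mul_le_mul_left _ (Nat.pow_le_pow_left (Nat.le_succ p) e)
    _ < (p + 1) ^ ((p + 1) * m) * (p + 1) ^ e := by
        refine Nat.mul_lt_mul_of_pos_right ?_ (by positivity)
        rcases Nat.eq_zero_or_pos (p ^ ((p + 1) * m)) with h0 | h0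
        · rw [h0, mul_zero]; positivity
        · exact lt_of_lt_of_le (Nat.mul_lt_mul_of_pos_right hN h0) h1
    _ = _ := by rw [pow_add]

open Classical in
theorem card_colorings_avoiding {V : Type*} [Fintype V] (p : ℕ) (A : Finset V) (i : Fin (p + 1)) :
    (Finset.univ.filter fun χ : V → Fin (p + 1) => ∀ a ∈ A, χ a ≠ i).card =
      p ^ A.card * (p + 1) ^ (Fintype.card V - A.card) := by
  have : (Finset.univ.filter fun χ : V → Fin (p + 1) => ∀ a ∈ A, χ a ≠ i) =
      Fintype.piFinset fun a => if a ∈ A then {i}ᶜ else Finset.univ := by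
    ext χ
    simp only [Finset.mem_filter, Finset.mem_univ, true_and, Fintype.mem_piFinset]
    refine forall_congr' fun a => ?_
    split_ifs with h <;> simp [h]
  rw [this, Fintype.card_piFinset]
  have h2 : ∀ a, (if a ∈ A then ({i}ᶜ : Finset (Fin (p + 1))) else Finset.univ).card =
      if a ∈ A then p else p + 1 := by
    intro a
    split_ifs <;> simp [Finset.card_compl]
  simp only [h2]
  rw [Finset.prod_ite]
  simp only [Finset.prod_const, Finset.filter_mem_eq_inter, Finset.univ_inter]
  congr 2
  rw [Finset.filter_not, Finset.filter_mem_eq_inter, Finset.univ_inter, Finset.card_sdiff]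
  simp [Finset.card_univ]

theorem exists_coloring_seeing_all {V : Type*} [Fintype V] (Q m : ℕ)
    (hm : Fintype.card V * Q < 2 ^ m) (hQ : 0 < Q) (A : V → Finset V) :
    ∃ χ : V → Fin Q, ∀ v, Q * m ≤ (A v).card → ∀ i, ∃ a ∈ A v, χ a = i := by
  classical
  obtain ⟨p, rfl⟩ : ∃ p, Q = p + 1 := ⟨Q - 1, by omega⟩
  by_contra! hcon
  let bad : V × Fin (p + 1) → Finset (V → Fin (p + 1)) := fun q =>
    if (p + 1) * m ≤ (A q.1).card then
      Finset.univ.filter fun χ : V → Fin (p + 1) => ∀ a ∈ A q.1, χ a ≠ q.2 else ∅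
  have hcover : (Finset.univ : Finset (V → Fin (p + 1))) ⊆ Finset.univ.biUnion bad := by
    intro χ _
    obtain ⟨v, hv, i, hi⟩ := hcon χ
    simp only [Finset.mem_biUnion, Finset.mem_univ, true_and]
    exact ⟨(v, i), by simpa [bad, hv] using hi⟩
  have hbad : ∀ q, (Fintype.card V * (p + 1)) * (bad q).card <
      (p + 1) ^ Fintype.card V := by
    intro q
    by_cases h : (p + 1) * m ≤ (A q.1).card
    · simp only [bad, h, if_true]
      rw [card_colorings_avoiding, ← mul_assoc]
      calc _ < (p + 1) ^ (A q.1).card * (p + 1) ^ (Fintype.card V - (A q.1).card) :=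
            Nat.mul_lt_mul_of_pos_right (two_pow_mul_pow_lt p m _ _ hm h) (by positivity)
        _ = _ := by rw [← pow_add, Nat.add_sub_cancel' (Finset.card_le_univ _)]
    · simp [bad, h]
  have h1 : (p + 1) ^ Fintype.card V ≤ ∑ q, (bad q).card := by
    calc _ = (Finset.univ : Finset (V → Fin (p + 1))).card := by simp [Finset.card_univ]
      _ ≤ _ := (Finset.card_le_card hcover).trans Finset.card_biUnion_le
  obtain ⟨v, -⟩ := hcon fun _ => 0
  have hcard : 0 < Fintype.card V * (p + 1) := by
    have : 0 < Fintype.card V := Fintype.card_pos_iff.2 ⟨v⟩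
    positivity
  have h2 : ∑ q, (Fintype.card V * (p + 1)) * (bad q).card <
      ∑ q : V × Fin (p + 1), (p + 1) ^ Fintype.card V :=
    Finset.sum_lt_sum_of_nonempty ⟨(v, 0), by simp⟩ fun q _ => hbad q
  rw [← Finset.mul_sum, Finset.sum_const, Finset.card_univ, Fintype.card_prod, Fintype.card_fin,
    smul_eq_mul] at h2
  exact absurd (Nat.lt_of_mul_lt_mul_left h2) (not_lt.2 h1)

/-- A finite set is divided into `Q` classes of at most `Q` elements, if `Q * Q` is at least its
cardinality. -/
theorem exists_small_classes (V : Type*) [Fintype V] (Q : ℕ) (hQ : Fintype.card V ≤ Q * Q) :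
    ∃ κ : V → Fin Q, ∀ i, ∀ S : Finset V, (∀ x ∈ S, κ x = i) → S.card ≤ Q := by
  classical
  have e := Fintype.equivFin V
  refine ⟨fun x => ⟨(e x : ℕ) / Q, ?_⟩, ?_⟩
  · exact Nat.div_lt_of_lt_mul ((e x).2.trans_le hQ)
  · intro i S hS
    have hinj : Set.InjOn (fun x => (e x : ℕ)) (S : Set V) := fun x _ y _ h =>
      e.injective (Fin.ext h)
    rw [← Finset.card_image_of_injOn hinj]
    have : S.image (fun x => (e x : ℕ)) ⊆ Finset.Ico (i * Q) (i * Q + Q) := by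
      intro m hm
      obtain ⟨x, hx, rfl⟩ := Finset.mem_image.1 hm
      have h := congrArg Fin.val (hS x hx)
      simp only at h
      have hQ0 : 0 < Q := i.pos
      rw [Finset.mem_Ico, ← h]
      have h1 := Nat.div_add_mod (e x : ℕ) Q
      have h2 := Nat.mod_lt (e x : ℕ) hQ0
      rw [Nat.mul_comm] at h1
      constructor <;> omega
    simpa using Finset.card_le_card this

/-! ### The verification algorithm -/

namespace GlobalMap

variable (g : GlobalMap)

/-- The identifier `a` occurs in the table of nodes. -/
def Listed (a : ℕ) : Prop := ∃ t, (a, t) ∈ g.vertices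

open Classical in
/-- The label, level and depth of `a` in the table of nodes. -/
noncomputable def entry (a : ℕ) : ℕ × ℕ × ℕ :=
  if h : g.Listed a then h.choose else default

noncomputable def label (a : ℕ) : ℕ := (g.entry a).1

noncomputable def level (a : ℕ) : ℕ := (g.entry a).2.1

noncomputable def depth (a : ℕ) : ℕ := (g.entry a).2.2

/-- The adjacency of `a` and `b` can be read off from the list of edges. -/
def Known (a b : ℕ) : Prop :=
  g.level a ≠ 0 ∨ g.level b ≠ 0 ∨ g.label a ≠ g.label b ∨ (a, b) ∈ g.known

/-- The nodes `me` and `a` are of level `0` and have the same label. -/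
def Own (me a : ℕ) : Prop := g.level me = 0 ∧ g.level a = 0 ∧ g.label a = g.label me

/-- The adjacency of `a` and `b` according to a node `me` that has access to the list `M` of
edges. -/
def Adjacent (me : ℕ) (M : Set (ℕ × ℕ)) (a b : ℕ) : Prop :=
  (g.Own me a ∧ g.Own me b ∧ (a, b) ∈ M) ∨ (¬ (g.Own me a ∧ g.Own me b) ∧ (a, b) ∈ g.edges)

end GlobalMap

/-- The adjacency `p` in the pattern is compatible with the adjacency `q` in the graph; non-edges
have to be preserved if `ind` holds. -/
def Respects (ind p q : Prop) : Prop := (p → q) ∧ (ind → q → p)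

theorem Respects.congr {ind p q q' : Prop} (h : q ↔ q') : Respects ind p q ↔ Respects ind p q' := by
  rw [Respects, Respects, h]

/-- The restriction of `φ` to `T` is a copy of the subgraph of `H` induced by `T`. -/
def IsCopyOn {W α : Type*} (H : SimpleGraph W) (ind : Prop) (adj : α → α → Prop) (T : Set W)
    (φ : W → α) : Prop :=
  Set.InjOn φ T ∧ ∀ a ∈ T, ∀ b ∈ T, a ≠ b → Respects ind (H.Adj a b) (adj (φ a) (φ b))

/-- The restriction of `φ` to `S ∪ R` is a copy in which `S` lies in the levels below `j`, in the
part of the graph with the same label as `c`, and in which `R` is sent to `c`, a vertex on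
level `j`. -/
structure IsRootedCopy {W α : Type*} (H : SimpleGraph W) (ind : Prop) (adj : α → α → Prop)
    (label level : α → ℕ) (j : ℕ) (S R : Set W) (c : α) (φ : W → α) : Prop where
  below : ∀ s ∈ S, label (φ s) = label c ∧ level (φ s) < j
  root : ∀ r ∈ R, φ r = c ∧ level c = j
  copy : IsCopyOn H ind adj (S ∪ R) φ

/-- The conditions verified by the node `me` with set of neighbours `nb`: here `near` is the set of
nodes at distance less than `k`, and `M a` is the set of edges that `a` finds in the certificates
of its neighbours. -/
structure NodeAccepts {W : Type*} (k : ℕ) (H : SimpleGraph W) (ind : Prop) (g : GlobalMap) (me : ℕ)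
    (nb near : Set ℕ) (M : ℕ → Set (ℕ × ℕ)) : Prop where
  listed : g.Listed me
  reachable : ∀ a, g.Listed a → Relation.ReflTransGen (fun a b => (a, b) ∈ g.edges) me a
  edge_sound : ∀ b, (me, b) ∈ g.edges → b ∈ nb
  edge_complete : ∀ b ∈ nb, (g.level me ≠ 0 ∨ g.level b ≠ 0 ∨ (me, b) ∈ g.known) →
    (me, b) ∈ g.edges
  label_eq : ∀ b ∈ nb, g.level me + 2 ≤ k → g.label b = g.label me
  level_le : ∀ b ∈ nb, g.level b ≤ g.level me + 1
  level_pred : 0 < g.level me → g.level me < k → ∃ b ∈ nb, g.level b + 1 = g.level me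
  depth_zero : g.depth me = 0 → g.label me = me
  depth_pred : 0 < g.depth me → ∃ b ∈ nb, g.depth b < g.depth me ∧ g.label b = g.label me ∧
    (g.level me + 2 ≤ k ∨ g.level b + 2 ≤ k)
  agree : ∀ a ∈ near, ∀ b ∈ near, g.level a = 0 → g.level b = 0 → M a = M b
  row : g.level me = 0 → ∀ b, (me, b) ∈ M me ↔ b ∈ nb
  no_copy : ¬ ∃ φ : W → ℕ, (∀ a, g.Listed (φ a)) ∧
    (∀ a b, a ≠ b → g.Known (φ a) (φ b) ∨ (g.Own me (φ a) ∧ g.Own me (φ b))) ∧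
    IsCopyOn H ind (g.Adjacent me (M me)) Set.univ φ
  representative : g.level me = 0 → ∀ j < k, ∀ S R : Set W, ∀ c, g.Listed c →
    g.label c = g.label me → ∀ φ : W → ℕ, (∀ a, g.Listed (φ a)) →
    IsRootedCopy H ind (g.Adjacent me (M me)) g.label g.level j S R c φ →
    ∃ φ' : W → ℕ, (∀ a, g.Listed (φ' a)) ∧
      IsRootedCopy H ind (g.Adjacent me (M me)) g.label g.level j S R c φ' ∧
      ∀ a ∈ S, ∀ b ∈ S, a ≠ b → g.Known (φ' a) (φ' b)

namespace LocalView

variable (w : LocalView)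

def neighbors (a : ℕ) : Set ℕ := {b | (a, b) ∈ w.edges}

/-- There is a visible walk with `i` edges from the center to `a`. -/
def Reaches : ℕ → ℕ → Prop
  | 0, a => a = w.center
  | i + 1, a => ∃ b, Reaches i b ∧ (b, a) ∈ w.edges

/-- The edges listed in the certificates of the visible neighbours of `a`. -/
def pieces (a : ℕ) : Set (ℕ × ℕ) :=
  {p | ∃ b ct, (a, b) ∈ w.edges ∧ (b, ct) ∈ w.nodes ∧ p ∈ (decodeCertificate ct).2}

/-- The verification algorithm. -/
def Accepts {W : Type*} (k : ℕ) (H : SimpleGraph W) (ind : Prop) : Prop :=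
  ∃ g, (∀ b ct, (b, ct) ∈ w.nodes → (decodeCertificate ct).1 = g) ∧
    NodeAccepts k H ind g w.center (w.neighbors w.center) {a | ∃ i < k, w.Reaches i a} w.pieces

end LocalView

section View

variable {V : Type*} (G : SimpleGraph V) (ident : V → ℕ) (cert : V → List Bool) {k : ℕ}

/-- The edges listed in the certificates of the neighbours of `u`. -/
def gatheredEdges (u : V) : Set (ℕ × ℕ) :=
  {p | ∃ y, G.Adj u y ∧ p ∈ (decodeCertificate (cert y)).2}

variable {G ident}

theorem edist_le_succ_of_adj {x y z : V} {i : ℕ} (h : G.edist x y ≤ i) (hyz : G.Adj y z) :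
    G.edist x z ≤ (i + 1 : ℕ) := by
  refine (G.edist_triangle (v := y)).trans ?_
  rw [SimpleGraph.edist_eq_one_iff_adj.2 hyz]
  push_cast
  gcongr

theorem mem_localView_edges (hid : Function.Injective ident) {x u : V} {i : ℕ}
    (hu : G.edist x u ≤ i) (hi : i < k) (b : ℕ) :
    (ident u, b) ∈ (localView G ident cert k x).edges ↔ ∃ y, G.Adj u y ∧ ident y = b := by
  simp only [localView, Set.mem_ofPred_eq, Prod.mk.injEq]
  constructor
  · rintro ⟨y, z, hyz, -, -, -, h1, rfl⟩
    obtain rfl := hid h1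
    exact ⟨z, hyz, rfl⟩
  · rintro ⟨y, huy, rfl⟩
    have hik : ((i : ℕ) : ℕ∞) < k := by exact_mod_cast hi
    refine ⟨u, y, huy, hu.trans hik.le, (edist_le_succ_of_adj hu huy).trans ?_, ?_, rfl, rfl⟩
    · exact_mod_cast hi
    · intro h
      exact (hu.trans_lt hik).ne h.1

theorem neighbors_localView (hid : Function.Injective ident) (hk : 0 < k) (x : V) :
    (localView G ident cert k x).neighbors (localView G ident cert k x).center =
      ident '' {y | G.Adj x y} := by
  ext b
  exact mem_localView_edges cert hid (i := 0) (by simp) hk b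

theorem reaches_localView_iff (hid : Function.Injective ident) {x : V} (a : ℕ) :
    (∃ i < k, (localView G ident cert k x).Reaches i a) ↔
      ∃ u, ident u = a ∧ ∃ i < k, G.edist x u ≤ i := by
  constructor
  · rintro ⟨i, hi, h⟩
    suffices ∃ u, ident u = a ∧ G.edist x u ≤ i by
      obtain ⟨u, hu, hi'⟩ := this
      exact ⟨u, hu, i, hi, hi'⟩
    clear hi
    induction i generalizing a with
    | zero => exact ⟨x, h.symm, by simp⟩
    | succ i ih =>
      obtain ⟨b, hb, hba⟩ := h
      obtain ⟨u, rfl, hu⟩ := ih b hb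
      obtain ⟨y, z, hyz, -, -, -, h1⟩ := hba
      simp only [Prod.mk.injEq] at h1
      obtain ⟨h1, rfl⟩ := h1
      obtain rfl := hid h1
      exact ⟨z, rfl, edist_le_succ_of_adj hu hyz⟩
  · rintro ⟨u, rfl, i, hi, hu⟩
    have hne : G.edist x u ≠ ⊤ := ne_top_of_le_ne_top (by simp) hu
    obtain ⟨p, hp⟩ := SimpleGraph.exists_walk_of_edist_ne_top hne
    have hpi : p.length < k := by
      rw [← hp] at hu
      have : p.length ≤ i := by exact_mod_cast hu
      omega
    clear hp hne hu hi
    refine ⟨p.length, hpi, ?_⟩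
    induction p using SimpleGraph.Walk.concatRec with
    | Hnil => rfl
    | Hconcat p h ih =>
      rw [SimpleGraph.Walk.length_concat] at hpi ⊢
      refine ⟨_, ih (by omega), ?_⟩
      exact (mem_localView_edges cert hid (SimpleGraph.edist_le p) (by omega) _).2 ⟨_, h, rfl⟩

theorem pieces_localView (hid : Function.Injective ident) {x u : V} {i : ℕ}
    (hu : G.edist x u ≤ i) (hi : i < k) :
    (localView G ident cert k x).pieces (ident u) = gatheredEdges G cert u := by
  ext p
  constructor
  · rintro ⟨b, ct, h1, ⟨z, -, h2⟩, h3⟩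
    obtain ⟨y, hy, rfl⟩ := (mem_localView_edges cert hid hu hi b).1 h1
    simp only [Prod.mk.injEq] at h2
    obtain ⟨h2, rfl⟩ := h2
    obtain rfl := hid h2
    exact ⟨y, hy, h3⟩
  · rintro ⟨y, hy, h⟩
    refine ⟨ident y, cert y, (mem_localView_edges cert hid hu hi _).2 ⟨y, hy, rfl⟩,
      ⟨y, (edist_le_succ_of_adj hu hy).trans ?_, rfl⟩, h⟩
    exact_mod_cast hi

theorem mem_localView_nodes {x y : V} (h : G.edist x y ≤ k) :
    (ident y, cert y) ∈ (localView G ident cert k x).nodes := ⟨y, h, rfl⟩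

end View

/-! ### Maps that are correct on a given network -/

/-- The table of nodes and the list of edges of `g` are correct for `G`, and the levels and labels
satisfy the constraints along the edges of `G`. -/
structure GlobalMap.IsCorrect {V : Type*} (g : GlobalMap) (k : ℕ) (G : SimpleGraph V)
    (ident : V → ℕ) : Prop where
  listed_iff : ∀ a, g.Listed a ↔ ∃ x, ident x = a
  edge_sound : ∀ x y, (ident x, ident y) ∈ g.edges → G.Adj x y
  edge_complete : ∀ x y, G.Adj x y → (g.level (ident x) ≠ 0 ∨ g.level (ident y) ≠ 0 ∨
    (ident x, ident y) ∈ g.known) → (ident x, ident y) ∈ g.edges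
  label_eq : ∀ x y, G.Adj x y → g.level (ident x) + 2 ≤ k →
    g.label (ident y) = g.label (ident x)
  level_le : ∀ x y, G.Adj x y → g.level (ident y) ≤ g.level (ident x) + 1

namespace GlobalMap

variable {V : Type*} {g : GlobalMap} {k : ℕ} {G : SimpleGraph V} {ident : V → ℕ}

theorem IsCorrect.edge_iff (h : g.IsCorrect k G ident) (hk : 2 ≤ k) {x y : V}
    (hxy : g.Known (ident x) (ident y)) : (ident x, ident y) ∈ g.edges ↔ G.Adj x y := by
  refine ⟨h.edge_sound x y, fun hadj => h.edge_complete x y hadj ?_⟩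
  rcases hxy with h1 | h1 | h1 | h1
  · exact Or.inl h1
  · exact Or.inr (Or.inl h1)
  · left
    intro h0
    exact h1 (h.label_eq x y hadj (by omega)).symm
  · exact Or.inr (Or.inr h1)

/-- `M` contains the right edges at the vertices of level `0` labelled as `x`. -/
def IsCorrectMapAt (g : GlobalMap) (G : SimpleGraph V) (ident : V → ℕ) (x : V)
    (M : Set (ℕ × ℕ)) : Prop :=
  ∀ y z, g.level (ident y) = 0 → g.label (ident y) = g.label (ident x) →
    ((ident y, ident z) ∈ M ↔ G.Adj y z)

theorem IsCorrect.adjacent_iff (h : g.IsCorrect k G ident) (hk : 2 ≤ k) {x y z : V}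
    {M : Set (ℕ × ℕ)} (hM : g.level (ident x) = 0 → g.IsCorrectMapAt G ident x M)
    (hxy : g.Known (ident y) (ident z) ∨
      (g.Own (ident x) (ident y) ∧ g.Own (ident x) (ident z))) :
    g.Adjacent (ident x) M (ident y) (ident z) ↔ G.Adj y z := by
  unfold Adjacent
  by_cases hown : g.Own (ident x) (ident y) ∧ g.Own (ident x) (ident z)
  · have := hM hown.1.1 y z hown.1.2.1 hown.1.2.2
    simp [hown.1, hown.2, this]
  · have h2 := h.edge_iff hk (hxy.resolve_right hown)
    rw [← h2]
    tauto

theorem known_or_own {x y z : ℕ} (hx : g.level x = 0) (hy : g.label y = g.label x)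
    (hz : g.label z = g.label x) : g.Known y z ∨ (g.Own x y ∧ g.Own x z) := by
  unfold Known Own
  tauto

/-- Rooted copies among the identifiers are the same as rooted copies in the graph. -/
theorem IsCorrect.isRootedCopy_iff {W : Type*} {H : SimpleGraph W} {ind : Prop}
    (h : g.IsCorrect k G ident) (hid : Function.Injective ident) (hk : 2 ≤ k) {x : V}
    {M : Set (ℕ × ℕ)} (hx : g.level (ident x) = 0) (hM : g.IsCorrectMapAt G ident x M)
    {j : ℕ} {S R : Set W} {c : V} (hc : g.label (ident c) = g.label (ident x)) {φ : W → V} :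
    IsRootedCopy H ind (g.Adjacent (ident x) M) g.label g.level j S R (ident c)
      (fun a => ident (φ a)) ↔
    IsRootedCopy H ind G.Adj (fun y => g.label (ident y)) (fun y => g.level (ident y)) j S R c
      φ := by
  have key : ∀ (_ : ∀ s ∈ S, g.label (ident (φ s)) = g.label (ident c) ∧
      g.level (ident (φ s)) < j) (_ : ∀ r ∈ R, φ r = c ∧ g.level (ident c) = j),
      IsCopyOn H ind (g.Adjacent (ident x) M) (S ∪ R) (fun a => ident (φ a)) ↔
        IsCopyOn H ind G.Adj (S ∪ R) φ := by
    intro hS hR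
    have hlab : ∀ a ∈ S ∪ R, g.label (ident (φ a)) = g.label (ident x) := by
      rintro a (ha | ha)
      · rw [(hS a ha).1, hc]
      · rw [(hR a ha).1, hc]
    refine and_congr ⟨fun hi a ha b hb hab => hi ha hb (congrArg ident hab),
      fun hi a ha b hb hab => hi ha hb (hid hab)⟩ ?_
    refine forall₂_congr fun a ha => forall₂_congr fun b hb => imp_congr_right fun _ => ?_
    exact Respects.congr (h.adjacent_iff hk (fun _ => hM)
      (known_or_own hx (hlab a ha) (hlab b hb)))
  constructor
  · rintro ⟨h1, h2, h3⟩
    have h2' : ∀ r ∈ R, φ r = c ∧ g.level (ident c) = j := fun r hr =>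
      ⟨hid (h2 r hr).1, (h2 r hr).2⟩
    exact ⟨h1, h2', (key h1 h2').1 h3⟩
  · rintro ⟨h1, h2, h3⟩
    exact ⟨h1, fun r hr => ⟨congrArg ident (h2 r hr).1, (h2 r hr).2⟩, (key h1 h2).2 h3⟩

end GlobalMap

/-! ### Replacing the low levels of a copy -/

section Replacement

variable {V W : Type*} {G : SimpleGraph V} {H : SimpleGraph W} {ind : Prop} {k : ℕ}
  {label level : V → ℕ} {K : V → V → Prop}

/-- The copy `f` has at most one vertex on some level of the part of the graph labelled `l`. -/
def IsThin (k : ℕ) (label level : V → ℕ) (f : W → V) (l : ℕ) : Prop :=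
  ∃ j < k, {a | label (f a) = l ∧ level (f a) = j}.Subsingleton

/-- Rooted copies can be replaced by rooted copies in which all pairs are in `K`. -/
def HasRepresentatives (k : ℕ) (H : SimpleGraph W) (ind : Prop) (G : SimpleGraph V)
    (label level : V → ℕ) (K : V → V → Prop) : Prop :=
  ∀ x, level x = 0 → ∀ j < k, ∀ S R : Set W, ∀ c, label c = label x → ∀ φ : W → V,
    IsRootedCopy H ind G.Adj label level j S R c φ →
    ∃ φ' : W → V, IsRootedCopy H ind G.Adj label level j S R c φ' ∧
      ∀ a ∈ S, ∀ b ∈ S, a ≠ b → K (φ' a) (φ' b)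

open Classical in
theorem exists_copy_known_at
    (hlab : ∀ x y, G.Adj x y → level x + 2 ≤ k → label y = label x)
    (hlev : ∀ x y, G.Adj x y → level y ≤ level x + 1)
    (hrep : HasRepresentatives k H ind G label level K)
    {f : W → V} (hf : IsCopyOn H ind G.Adj Set.univ f) {l : ℕ} (hl : IsThin k label level f l) :
    ∃ f' : W → V, IsCopyOn H ind G.Adj Set.univ f' ∧ (∀ a, label (f a) ≠ l → f' a = f a) ∧
      (∀ a, label (f' a) = label (f a)) ∧
      ∀ a b, a ≠ b → label (f' a) = l → label (f' b) = l → level (f' a) = 0 →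
        level (f' b) = 0 → K (f' a) (f' b) := by
  by_cases hhigh : ∃ a₀, label (f a₀) = l ∧ level (f a₀) = 0
  swap
  · push Not at hhigh
    exact ⟨f, hf, fun _ _ => rfl, fun _ => rfl, fun a b _ ha _ ha' => absurd ha' (hhigh a ha)⟩
  obtain ⟨a₀, rfl, ha₀⟩ := hhigh
  obtain ⟨j, hjk, hj⟩ := hl
  set S : Set W := {a | label (f a) = label (f a₀) ∧ level (f a) < j} with hS
  set R : Set W := {a | label (f a) = label (f a₀) ∧ level (f a) = j} with hR
  obtain ⟨c, hc, hcR⟩ : ∃ c, label c = label (f a₀) ∧ ∀ r ∈ R, f r = c ∧ level c = j := by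
    by_cases h : R.Nonempty
    · obtain ⟨r, hr⟩ := h
      refine ⟨f r, hr.1, fun r' hr' => ?_⟩
      rw [hj hr' hr]
      exact ⟨rfl, hr.2⟩
    · exact ⟨f a₀, rfl, fun r hr => absurd ⟨r, hr⟩ h⟩
  obtain ⟨φ, hφ, hK⟩ := hrep (f a₀) ha₀ j hjk S R c hc f
    ⟨fun s hs => ⟨hs.1.trans hc.symm, hs.2⟩, hcR,
      hf.1.mono (Set.subset_univ _), fun a _ b _ => hf.2 a trivial b trivial⟩
  have hφS : ∀ a ∈ S, label (φ a) = label (f a₀) ∧ level (φ a) < j := fun a ha =>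
    ⟨(hφ.below a ha).1.trans hc, (hφ.below a ha).2⟩
  have hφR : ∀ a ∈ R, φ a = f a := fun a ha => (hφ.root a ha).1.trans (hcR a ha).1.symm
  -- a vertex of label `l` below level `j` is only adjacent to vertices of label `l` up to level `j`
  have hsep : ∀ y, label y = label (f a₀) → level y < j → ∀ b, b ∉ S ∪ R → ¬ G.Adj y (f b) := by
    intro y hy hyj b hb hadj
    have h1 := hlab _ _ hadj (by omega)
    have h2 := hlev _ _ hadj
    rw [hy] at h1
    rcases Nat.lt_or_ge (level (f b)) j with h3 | h3
    · exact hb (Or.inl ⟨h1, h3⟩)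
    · exact hb (Or.inr ⟨h1, by omega⟩)
  have hne : ∀ y, label y = label (f a₀) → level y < j → ∀ b, b ∉ S ∪ R → y ≠ f b := by
    rintro y hy hyj b hb rfl
    exact hb (Or.inl ⟨hy, hyj⟩)
  let f' : W → V := fun a => if a ∈ S then φ a else f a
  have hf'S : ∀ a ∈ S, f' a = φ a := fun a ha => by simp [f', ha]
  have hf'n : ∀ a, a ∉ S → f' a = f a := fun a ha => by simp [f', ha]
  have hf'SR : ∀ a ∈ S ∪ R, f' a = φ a := by
    intro a ha
    by_cases haS : a ∈ S
    · exact hf'S a haS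
    · rw [hf'n a haS, hφR a (ha.resolve_left haS)]
  have hlabel : ∀ a, label (f' a) = label (f a) := by
    intro a
    by_cases ha : a ∈ S
    · rw [hf'S a ha, (hφS a ha).1]
      exact ha.1.symm
    · rw [hf'n a ha]
  refine ⟨f', ⟨?_, ?_⟩, ?_, hlabel, ?_⟩
  · intro a _ b _ hab
    by_cases ha : a ∈ S ∪ R <;> by_cases hb : b ∈ S ∪ R
    · rw [hf'SR a ha, hf'SR b hb] at hab
      exact hφ.copy.1 ha hb hab
    · have hbS : b ∉ S := fun h => hb (Or.inl h)
      by_cases haS : a ∈ S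
      · rw [hf'S a haS, hf'n b hbS] at hab
        exact absurd hab (hne _ (hφS a haS).1 (hφS a haS).2 b hb)
      · rw [hf'n a haS, hf'n b hbS] at hab
        exact hf.1 trivial trivial hab
    · have haS : a ∉ S := fun h => ha (Or.inl h)
      by_cases hbS : b ∈ S
      · rw [hf'S b hbS, hf'n a haS] at hab
        exact absurd hab.symm (hne _ (hφS b hbS).1 (hφS b hbS).2 a ha)
      · rw [hf'n a haS, hf'n b hbS] at hab
        exact hf.1 trivial trivial hab
    · rw [hf'n a fun h => ha (Or.inl h), hf'n b fun h => hb (Or.inl h)] at hab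
      exact hf.1 trivial trivial hab
  · intro a _ b _ hab
    have hold := hf.2 a trivial b trivial hab
    by_cases ha : a ∈ S ∪ R <;> by_cases hb : b ∈ S ∪ R
    · rw [hf'SR a ha, hf'SR b hb]
      exact hφ.copy.2 a ha b hb hab
    · have hbS : b ∉ S := fun h => hb (Or.inl h)
      by_cases haS : a ∈ S
      · rw [hf'S a haS, hf'n b hbS]
        refine (Respects.congr ?_).1 hold
        exact iff_of_false (hsep _ haS.1 haS.2 b hb) (hsep _ (hφS a haS).1 (hφS a haS).2 b hb)
      · rwa [hf'n a haS, hf'n b hbS]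
    · have haS : a ∉ S := fun h => ha (Or.inl h)
      by_cases hbS : b ∈ S
      · rw [hf'S b hbS, hf'n a haS]
        refine (Respects.congr ?_).1 hold
        rw [G.adj_comm, G.adj_comm (f a)]
        exact iff_of_false (hsep _ hbS.1 hbS.2 a ha) (hsep _ (hφS b hbS).1 (hφS b hbS).2 a ha)
      · rwa [hf'n a haS, hf'n b hbS]
    · rwa [hf'n a fun h => ha (Or.inl h), hf'n b fun h => hb (Or.inl h)]
  · intro a ha
    exact hf'n a fun h => ha h.1
  · intro a b hab ha hb ha0 hb0
    have hmem : ∀ a, label (f' a) = label (f a₀) → level (f' a) = 0 → a ∉ S → a ∈ R ∧ j = 0 := by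
      intro a ha ha0 haS
      rw [hf'n a haS] at ha ha0
      have : j = 0 := by
        by_contra h
        exact haS ⟨ha, by omega⟩
      exact ⟨⟨ha, by omega⟩, this⟩
    by_cases haS : a ∈ S <;> by_cases hbS : b ∈ S
    · rw [hf'S a haS, hf'S b hbS]
      exact hK a haS b hbS hab
    · have := haS.2
      have := (hmem b hb hb0 hbS).2
      omega
    · have := hbS.2
      have := (hmem a ha ha0 haS).2
      omega
    · exact absurd (hj (hmem a ha ha0 haS).1 (hmem b hb hb0 hbS).1) hab

theorem exists_copy_known
    (hlab : ∀ x y, G.Adj x y → level x + 2 ≤ k → label y = label x)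
    (hlev : ∀ x y, G.Adj x y → level y ≤ level x + 1)
    (hrep : HasRepresentatives k H ind G label level K)
    {f : W → V} (hf : IsCopyOn H ind G.Adj Set.univ f) (A : Finset ℕ)
    (hA : ∀ l ∈ A, IsThin k label level f l) :
    ∃ f' : W → V, IsCopyOn H ind G.Adj Set.univ f' ∧ (∀ a, label (f a) ∉ A → f' a = f a) ∧
      (∀ a, label (f' a) = label (f a)) ∧
      ∀ a b, a ≠ b → label (f' a) ∈ A → label (f' b) = label (f' a) → level (f' a) = 0 →
        level (f' b) = 0 → K (f' a) (f' b) := by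
  induction A using Finset.induction_on with
  | empty => exact ⟨f, hf, fun _ _ => rfl, fun _ => rfl, by simp⟩
  | insert l A hl ih =>
    obtain ⟨f₁, h1, h2, h3, h4⟩ := ih fun l' hl' => hA l' (Finset.mem_insert_of_mem hl')
    have hthin : IsThin k label level f₁ l := by
      obtain ⟨j, hj, hsub⟩ := hA l (Finset.mem_insert_self l A)
      refine ⟨j, hj, hsub.anti fun a ha => ?_⟩
      have hal := ha.1
      rw [h3] at hal
      have := ha.2
      rw [h2 a (by rwa [hal])] at this
      exact ⟨hal, this⟩
    obtain ⟨f₂, g1, g2, g3, g4⟩ := exists_copy_known_at hlab hlev hrep h1 hthin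
    refine ⟨f₂, g1, fun a ha => ?_, fun a => (g3 a).trans (h3 a), ?_⟩
    · rw [Finset.mem_insert, not_or] at ha
      rw [g2 a (by rw [h3]; exact ha.1), h2 a ha.2]
    · intro a b hab ha hb ha0 hb0
      by_cases hal : label (f₂ a) = l
      · exact g4 a b hab hal (hb.trans hal) ha0 hb0
      · have ha' := g2 a (by rwa [← g3])
        have hb' := g2 b (by rwa [← g3, hb])
        rw [ha', hb'] at hb
        rw [ha'] at ha ha0 hal
        rw [hb'] at hb0
        rw [ha', hb']
        exact h4 a b hab ((Finset.mem_insert.1 ha).resolve_left hal) hb ha0 hb0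

theorem isThin_or_isThin [Fintype W] (hW : Fintype.card W < 4 * k) (f : W → V)
    {l l' : ℕ} (hl : l ≠ l') : IsThin k label level f l ∨ IsThin k label level f l' := by
  classical
  by_contra! hcon
  have key : ∀ l, ¬ IsThin k label level f l →
      2 * k ≤ (Finset.univ.filter fun a => label (f a) = l).card := by
    intro l hl
    by_contra! hlt
    obtain ⟨j, hj, hj2⟩ := Finset.exists_card_fiber_lt_of_card_lt_mul (t := Finset.range k) (n := 2)
      (s := Finset.univ.filter fun a => label (f a) = l) (f := fun a => level (f a))
      (by rw [Finset.card_range]; omega)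
    refine hl ⟨j, Finset.mem_range.1 hj, fun a ha b hb => ?_⟩
    exact Finset.card_le_one.1 (Nat.le_of_lt_succ hj2) a (by simpa using ha) b (by simpa using hb)
  have h1 := key l hcon.1
  have h2 := key l' hcon.2
  have hdisj : Disjoint (Finset.univ.filter fun a => label (f a) = l)
      (Finset.univ.filter fun a => label (f a) = l') := by
    rw [Finset.disjoint_filter]
    intro a _ ha ha'
    exact hl (ha.symm.trans ha')
  have h3 := Finset.card_le_univ ((Finset.univ.filter fun a => label (f a) = l) ∪
    (Finset.univ.filter fun a => label (f a) = l'))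
  rw [Finset.card_union_of_disjoint hdisj] at h3
  omega

end Replacement

/-! ### Soundness -/

section Soundness

variable {V W : Type*} {G : SimpleGraph V} {H : SimpleGraph W} {ind : Prop} {k : ℕ}
  {ident : V → ℕ} {g : GlobalMap}

/-- If `g` is correct, and the tests for copies and representatives succeed, then there is no
copy. -/
theorem no_copy_of_isCorrect [Fintype W] [Nonempty V] (hg : g.IsCorrect k G ident)
    (hid : Function.Injective ident) (hk : 2 ≤ k) (hW : Fintype.card W < 4 * k)
    (M : V → Set (ℕ × ℕ))
    (hM : ∀ x, g.level (ident x) = 0 → g.IsCorrectMapAt G ident x (M x))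
    {nb near : V → Set ℕ} {N : V → ℕ → Set (ℕ × ℕ)} (hN : ∀ x, N x (ident x) = M x)
    (hacc : ∀ x, NodeAccepts k H ind g (ident x) (nb x) (near x) (N x)) (f : W → V) :
    ¬ IsCopyOn H ind G.Adj Set.univ f := by
  classical
  intro hf
  have hrep : HasRepresentatives k H ind G (fun y => g.label (ident y))
      (fun y => g.level (ident y)) (fun y z => g.Known (ident y) (ident z)) := by
    intro x hx j hj S R c hc φ hφ
    obtain ⟨φ', hreal, h1, h2⟩ := (hacc x).representative hx j hj S R (ident c)
      ((hg.listed_iff _).2 ⟨c, rfl⟩) hc (fun a => ident (φ a))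
      (fun a => (hg.listed_iff _).2 ⟨_, rfl⟩)
      (by rw [hN]; exact (hg.isRootedCopy_iff hid hk hx (hM x hx) hc).2 hφ)
    choose ψ hψ using fun a => (hg.listed_iff _).1 (hreal a)
    obtain rfl : (fun a => ident (ψ a)) = φ' := funext hψ
    rw [hN] at h1
    exact ⟨ψ, (hg.isRootedCopy_iff hid hk hx (hM x hx) hc).1 h1, h2⟩
  let A : Finset ℕ := (Finset.univ.image fun a => g.label (ident (f a))).filter fun l =>
    IsThin k (fun y => g.label (ident y)) (fun y => g.level (ident y)) f l
  obtain ⟨f', h1, -, h3, h4⟩ := exists_copy_known hg.label_eq hg.level_le hrep hf A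
    fun l hl => (Finset.mem_filter.1 hl).2
  have hA : ∀ a b, g.label (ident (f' a)) ∉ A → g.label (ident (f' b)) ∉ A →
      g.label (ident (f' a)) = g.label (ident (f' b)) := by
    intro a b ha hb
    by_contra hne
    rw [h3 a] at ha hne
    rw [h3 b] at hb hne
    rcases isThin_or_isThin hW f hne with h | h
    · exact ha (Finset.mem_filter.2 ⟨Finset.mem_image_of_mem _ (Finset.mem_univ a), h⟩)
    · exact hb (Finset.mem_filter.2 ⟨Finset.mem_image_of_mem _ (Finset.mem_univ b), h⟩)
  obtain ⟨x, hx⟩ : ∃ x, ∀ a, g.level (ident (f' a)) = 0 → g.label (ident (f' a)) ∉ A →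
      g.Own (ident x) (ident (f' a)) := by
    by_cases h : ∃ a, g.level (ident (f' a)) = 0 ∧ g.label (ident (f' a)) ∉ A
    · obtain ⟨a, ha, haA⟩ := h
      exact ⟨f' a, fun b hb hbA => ⟨ha, hb, hA b a hbA haA⟩⟩
    · push Not at h
      exact ⟨Classical.arbitrary V, fun a ha haA => absurd (h a ha) haA⟩
  have hknown : ∀ a b, a ≠ b → g.Known (ident (f' a)) (ident (f' b)) ∨
      (g.Own (ident x) (ident (f' a)) ∧ g.Own (ident x) (ident (f' b))) := by
    intro a b hab
    by_cases ha0 : g.level (ident (f' a)) = 0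
    swap
    · exact Or.inl (Or.inl ha0)
    by_cases hb0 : g.level (ident (f' b)) = 0
    swap
    · exact Or.inl (Or.inr (Or.inl hb0))
    by_cases hl : g.label (ident (f' a)) = g.label (ident (f' b))
    swap
    · exact Or.inl (Or.inr (Or.inr (Or.inl hl)))
    by_cases haA : g.label (ident (f' a)) ∈ A
    · exact Or.inl (h4 a b hab haA hl.symm ha0 hb0)
    · exact Or.inr ⟨hx a ha0 haA, hx b hb0 (hl ▸ haA)⟩
  refine (hacc x).no_copy ⟨fun a => ident (f' a), fun a => (hg.listed_iff _).2 ⟨_, rfl⟩, hknown,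
    fun a _ b _ hab => h1.1 trivial trivial (hid hab), fun a _ b _ hab => ?_⟩
  rw [hN]
  exact (Respects.congr (hg.adjacent_iff hk (hM x) (hknown a b hab))).2
    (h1.2 a trivial b trivial hab)

theorem isCorrect_of_nodeAccepts [Nonempty V] (hid : Function.Injective ident)
    {near : V → Set ℕ} {N : V → ℕ → Set (ℕ × ℕ)}
    (hacc : ∀ x, NodeAccepts k H ind g (ident x) (ident '' {y | G.Adj x y}) (near x) (N x)) :
    g.IsCorrect k G ident where
  listed_iff a := by
    constructor
    · intro ha
      obtain ⟨x⟩ := ‹Nonempty V›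
      have := (hacc x).reachable a ha
      clear ha
      induction this with
      | refl => exact ⟨x, rfl⟩
      | tail _ h ih =>
        obtain ⟨y, rfl⟩ := ih
        obtain ⟨z, -, hz⟩ := (hacc y).edge_sound _ h
        exact ⟨z, hz⟩
    · rintro ⟨x, rfl⟩
      exact (hacc x).listed
  edge_sound x y h := by
    obtain ⟨z, hz, hzy⟩ := (hacc x).edge_sound _ h
    rwa [← hid hzy]
  edge_complete x y h := (hacc x).edge_complete _ ⟨y, h, rfl⟩
  label_eq x y h := (hacc x).label_eq _ ⟨y, h, rfl⟩
  level_le x y h := (hacc x).level_le _ ⟨y, h, rfl⟩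

/-- All the vertices of level `0` with the same label gather the same edges. -/
theorem gathered_eq_of_nodeAccepts (hk : 2 ≤ k)
    (cert : V → List Bool) {N : V → ℕ → Set (ℕ × ℕ)}
    (hN : ∀ x u, ∀ i < k, G.edist x u ≤ i → N x (ident u) = gatheredEdges G cert u)
    (hid : Function.Injective ident)
    (hacc : ∀ x, NodeAccepts k H ind g (ident x) (ident '' {y | G.Adj x y})
      {a | ∃ u, ident u = a ∧ ∃ i < k, G.edist x u ≤ i} (N x))
    {x y : V} (hx : g.level (ident x) = 0) (hy : g.level (ident y) = 0)
    (hxy : g.label (ident y) = g.label (ident x)) :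
    gatheredEdges G cert x = gatheredEdges G cert y := by
  have hagree : ∀ x u v, g.level (ident u) = 0 → g.level (ident v) = 0 → ∀ i < k, ∀ j < k,
      G.edist x u ≤ i → G.edist x v ≤ j → gatheredEdges G cert u = gatheredEdges G cert v := by
    intro x u v hu hv i hi j hj hui hvj
    rw [← hN x u i hi hui, ← hN x v j hj hvj]
    exact (hacc x).agree _ ⟨u, rfl, i, hi, hui⟩ _ ⟨v, rfl, j, hj, hvj⟩ hu hv
  have hhigh : ∀ i < k, ∀ x, g.level (ident x) = i →
      ∃ u, g.level (ident u) = 0 ∧ G.edist x u ≤ i := by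
    intro i
    induction i with
    | zero => exact fun _ x hx => ⟨x, hx, by simp⟩
    | succ i ih =>
      intro hi x hx
      obtain ⟨-, ⟨y, hxy, rfl⟩, hy⟩ := (hacc x).level_pred (by omega) (by omega)
      obtain ⟨u, hu, hyu⟩ := ih (by omega) y (by omega)
      refine ⟨u, hu, ?_⟩
      rw [SimpleGraph.edist_comm] at hyu ⊢
      exact edist_le_succ_of_adj hyu hxy.symm
  have hprop : ∀ d x, g.depth (ident x) = d → g.level (ident x) < k → ∀ u,
      g.level (ident u) = 0 → ∀ i < k, G.edist x u ≤ i →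
      ∃ r, ident r = g.label (ident x) ∧ ∃ v, g.level (ident v) = 0 ∧ ∃ j < k, G.edist r v ≤ j ∧
        gatheredEdges G cert u = gatheredEdges G cert v := by
    intro d
    induction d using Nat.strong_induction_on with
    | _ d ih =>
    intro x hxd hxk u hu i hi hui
    rcases Nat.eq_zero_or_pos (g.depth (ident x)) with h0 | h0
    · exact ⟨x, ((hacc x).depth_zero h0).symm, u, hu, i, hi, hui, rfl⟩
    · obtain ⟨-, ⟨y, hxy, rfl⟩, hyd, hyl, hor⟩ := (hacc x).depth_pred h0
      have hy1 := (hacc x).level_le _ ⟨y, hxy, rfl⟩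
      obtain ⟨v, hv, j, hj, hvx, hvy⟩ : ∃ v, g.level (ident v) = 0 ∧ ∃ j < k,
          G.edist x v ≤ j ∧ G.edist y v ≤ j := by
        rcases hor with h | h
        · obtain ⟨v, hv, hxv⟩ := hhigh _ hxk x rfl
          refine ⟨v, hv, g.level (ident x) + 1, by omega, hxv.trans (by simp), ?_⟩
          rw [SimpleGraph.edist_comm] at hxv ⊢
          exact edist_le_succ_of_adj hxv hxy
        · obtain ⟨v, hv, hyv⟩ := hhigh _ (by omega) y rfl
          refine ⟨v, hv, g.level (ident y) + 1, by omega, ?_, hyv.trans (by simp)⟩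
          rw [SimpleGraph.edist_comm] at hyv ⊢
          exact edist_le_succ_of_adj hyv hxy.symm
      obtain ⟨r, hr, v', hv', j', hj', hrv', heq⟩ := ih _ (hxd ▸ hyd) y rfl (by omega) v hv j hj hvy
      exact ⟨r, hr.trans hyl, v', hv', j', hj', hrv',
        (hagree x u v hu hv i hi j hj hui hvx).trans heq⟩
  obtain ⟨r, hr, v, hv, i, hi, hrv, h1⟩ := hprop _ x rfl (by omega) x hx 0 (by omega) (by simp)
  obtain ⟨r', hr', v', hv', j, hj, hrv', h2⟩ := hprop _ y rfl (by omega) y hy 0 (by omega) (by simp)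
  obtain rfl : r' = r := hid (by rw [hr, hr', hxy])
  rw [h1, h2]
  exact hagree r' v v' hv hv' i hi j hj hrv hrv'

/-- If all the vertices accept, then there is no copy of the pattern. -/
theorem no_copy_of_accepts [Fintype W] (hk : 2 ≤ k) (hW : Fintype.card W < 4 * k)
    (hG : G.Connected) (hid : Function.Injective ident) (cert : V → List Bool)
    (hacc : ∀ x, (localView G ident cert k x).Accepts k H ind) (f : W → V) :
    ¬ IsCopyOn H ind G.Adj Set.univ f := by
  have hne : Nonempty V := hG.nonempty
  choose m hm hacc using hacc
  have hself : ∀ x, (decodeCertificate (cert x)).1 = m x := fun x =>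
    hm x _ _ (mem_localView_nodes cert (x := x) (y := x) (by simp))
  have hconst : ∀ x y, m x = m y := by
    intro x y
    obtain ⟨p⟩ := hG.preconnected x y
    induction p with
    | nil => rfl
    | cons h p ih =>
      rw [← ih, ← hself, hm _ _ _ (mem_localView_nodes cert _)]
      rw [SimpleGraph.edist_comm, SimpleGraph.edist_eq_one_iff_adj.2 h]
      exact_mod_cast (by omega : 1 ≤ k)
  obtain ⟨x₀⟩ := hne
  obtain ⟨g, hg⟩ : ∃ g, ∀ x, m x = g := ⟨m x₀, fun x => hconst x x₀⟩
  simp only [hg, neighbors_localView cert hid (by omega : 0 < k),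
    reaches_localView_iff cert hid] at hacc
  have : Nonempty V := ⟨x₀⟩
  have hN : ∀ x u, ∀ i < k, G.edist x u ≤ i → (localView G ident cert k x).pieces (ident u) =
      gatheredEdges G cert u := fun x u i hi hu => pieces_localView cert hid hu hi
  have hN0 : ∀ x, (localView G ident cert k x).pieces (ident x) = gatheredEdges G cert x :=
    fun x => hN x x 0 (by omega) (by simp)
  refine no_copy_of_isCorrect (isCorrect_of_nodeAccepts hid hacc) hid hk hW
    (gatheredEdges G cert) ?_ hN0 hacc f
  intro x hx y z hy hxy
  rw [gathered_eq_of_nodeAccepts hk cert hN hid hacc hx hy hxy, ← hN0]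
  refine ((hacc y).row hy _).trans ?_
  constructor
  · rintro ⟨z', hz', h⟩
    rwa [← hid h]
  · intro h
    exact ⟨z, h, rfl⟩

end Soundness

/-! ### Completeness -/

section Completeness

variable {V W : Type*}

/-- Existence of the levels (the distance to `A`, truncated at `k`), of the labels (a vertex chosen
in each zone around `A`) and of the depths (the distance to the label within the zone). -/
theorem exists_labelling [Fintype V] {k : ℕ} (hk : 2 ≤ k) (G : SimpleGraph V) (A : Set V) :
    ∃ (label : V → V) (level depth : V → ℕ), (∀ x, level x = 0 ↔ x ∈ A) ∧ (∀ x, level x ≤ k) ∧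
      (∀ x, depth x < Fintype.card V) ∧
      (∀ x y, G.Adj x y → level x + 2 ≤ k → label y = label x) ∧
      (∀ x y, G.Adj x y → level y ≤ level x + 1) ∧
      (∀ x, 0 < level x → level x < k → ∃ y, G.Adj x y ∧ level y + 1 = level x) ∧
      (∀ x, depth x = 0 → label x = x) ∧
      (∀ x, 0 < depth x → ∃ y, G.Adj x y ∧ depth y < depth x ∧ label y = label x ∧
        (level x + 2 ≤ k ∨ level y + 2 ≤ k)) := by
  let D : V → Set ℕ := fun x => {i | i = k ∨ ∃ u ∈ A, ∃ p : G.Walk x u, p.length = i}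
  let level : V → ℕ := fun x => sInf (D x)
  have hmem : ∀ x, level x ∈ D x := fun x => Nat.sInf_mem ⟨k, Or.inl rfl⟩
  have hle : ∀ x, ∀ i ∈ D x, level x ≤ i := fun x i hi => Nat.sInf_le hi
  have hlek : ∀ x, level x ≤ k := fun x => hle x k (Or.inl rfl)
  have hsucc : ∀ x y, G.Adj x y → level y ≤ level x + 1 := by
    intro x y hxy
    rcases hmem x with h | ⟨u, hu, p, hp⟩
    · rw [h]
      exact (hlek y).trans (Nat.le_succ k)
    · exact hle y _ (Or.inr ⟨u, hu, SimpleGraph.Walk.cons hxy.symm p, by simp [hp]⟩)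
  let Γ : SimpleGraph V :=
    { Adj := fun x y => G.Adj x y ∧ (level x + 2 ≤ k ∨ level y + 2 ≤ k)
      symm := ⟨fun x y h => ⟨h.1.symm, h.2.symm⟩⟩
      loopless := ⟨fun x h => G.loopless.irrefl x h.1⟩ }
  let label : V → V := fun x => (Γ.connectedComponentMk x).out
  have hlabel : ∀ x, Γ.Reachable x (label x) := fun x =>
    SimpleGraph.ConnectedComponent.exact (Quot.out_eq (Γ.connectedComponentMk x)).symm
  have hadj : ∀ x y, Γ.Adj x y → label y = label x := fun x y h =>
    congrArg Quot.out (SimpleGraph.ConnectedComponent.sound h.symm.reachable)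
  refine ⟨label, level, fun x => Γ.dist x (label x), ?_, hlek, ?_, ?_, hsucc, ?_, ?_, ?_⟩
  · intro x
    constructor
    · intro hx
      rcases hmem x with h | ⟨u, hu, p, hp⟩
      · omega
      · rw [hx] at hp
        rwa [SimpleGraph.Walk.eq_of_length_eq_zero hp]
    · intro hx
      exact Nat.le_zero.1 (hle x 0 (Or.inr ⟨x, hx, SimpleGraph.Walk.nil, rfl⟩))
  · intro x
    obtain ⟨p, hp, hlen⟩ := (hlabel x).exists_path_of_dist
    exact lt_of_eq_of_lt hlen.symm hp.length_lt
  · intro x y hxy hx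
    exact hadj x y ⟨hxy, Or.inl hx⟩
  · intro x hx hxk
    rcases hmem x with h | ⟨u, hu, p, hp⟩
    · omega
    · cases p with
      | nil => simp at hp; omega
      | cons h p =>
        rw [SimpleGraph.Walk.length_cons] at hp
        have h1 := hle _ _ (Or.inr ⟨u, hu, p, rfl⟩)
        have h2 := hsucc _ _ h.symm
        exact ⟨_, h, by omega⟩
  · intro x hx
    exact ((hlabel x).dist_eq_zero_iff.1 hx).symm
  · intro x hx
    obtain ⟨p, hp⟩ := (hlabel x).exists_walk_length_eq_dist
    generalize hr : label x = r at p hp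
    cases p with
    | nil => simp [hr] at hx
    | @cons _ y _ h p =>
      rw [SimpleGraph.Walk.length_cons] at hp
      have h1 : label y = r := (hadj _ _ h).trans hr
      refine ⟨y, h.1, ?_, h1, h.2⟩
      simp only [h1, hr]
      have := SimpleGraph.dist_le p
      omega

open Classical in
/-- A small set of pairs suffices to represent all rooted copies. -/
theorem exists_hasRepresentatives [Fintype V] [Fintype W] (k : ℕ) (H : SimpleGraph W) (ind : Prop)
    (G : SimpleGraph V) (label level : V → ℕ) :
    ∃ K : Finset (V × V),
      K.card ≤ Fintype.card V * (k * 4 ^ Fintype.card W * Fintype.card W ^ 2) ∧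
      HasRepresentatives k H ind G label level fun x y => (x, y) ∈ K := by
  rcases isEmpty_or_nonempty V with hV | hV
  · exact ⟨∅, by simp, fun x => isEmptyElim x⟩
  let F : V × Fin k × Set W × Set W → W → V := fun q =>
    Classical.epsilon (IsRootedCopy H ind G.Adj label level q.2.1 q.2.2.1 q.2.2.2 q.1)
  refine ⟨(Finset.univ : Finset ((V × Fin k × Set W × Set W) × (W × W))).image
    fun q => (F q.1 q.2.1, F q.1 q.2.2), ?_, ?_⟩
  · refine Finset.card_image_le.trans (le_of_eq ?_)
    simp only [Finset.card_univ, Fintype.card_prod, Fintype.card_fin, Fintype.card_set]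
    rw [show (4 : ℕ) = 2 * 2 from rfl, mul_pow]
    ring
  · intro x _ j hj S R c _ φ hφ
    refine ⟨F (c, ⟨j, hj⟩, S, R), Classical.epsilon_spec (p := IsRootedCopy H ind G.Adj label level
      j S R c) ⟨φ, hφ⟩, fun a _ b _ _ => ?_⟩
    exact Finset.mem_image.2 ⟨((c, ⟨j, hj⟩, S, R), (a, b)), Finset.mem_univ _, rfl⟩

/-- The list of the pairs of identifiers of a set of pairs of vertices. -/
noncomputable def identPairs (ident : V → ℕ) (E : Finset (V × V)) : List (ℕ × ℕ) :=
  E.toList.map fun p => (ident p.1, ident p.2)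

theorem length_identPairs (ident : V → ℕ) (E : Finset (V × V)) :
    (identPairs ident E).length = E.card := by simp [identPairs]

theorem mem_identPairs {ident : V → ℕ} (hid : Function.Injective ident) {E : Finset (V × V)}
    {x y : V} : (ident x, ident y) ∈ identPairs ident E ↔ (x, y) ∈ E := by
  simp [identPairs, hid.eq_iff]

theorem exists_of_mem_identPairs {ident : V → ℕ} {E : Finset (V × V)} {p : ℕ × ℕ}
    (hp : p ∈ identPairs ident E) : ∃ x y, (x, y) ∈ E ∧ p = (ident x, ident y) := by
  simp only [identPairs, List.mem_map, Finset.mem_toList, Prod.exists] at hp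
  obtain ⟨x, y, h, rfl⟩ := hp
  exact ⟨x, y, h, rfl⟩

/-- The map of a network given by functions and sets on its vertices. -/
noncomputable def networkMap [Fintype V] (ident : V → ℕ) (label : V → V) (level depth : V → ℕ)
    (E K : Finset (V × V)) : GlobalMap where
  vertices := Finset.univ.toList.map fun x => (ident x, ident (label x), level x, depth x)
  edges := identPairs ident E
  known := identPairs ident K

section networkMap

variable [Fintype V] {ident : V → ℕ} (label : V → V) (level depth : V → ℕ) (E K : Finset (V × V))

theorem listed_networkMap (a : ℕ) :
    (networkMap ident label level depth E K).Listed a ↔ ∃ x, ident x = a := by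
  simp only [GlobalMap.Listed, networkMap, List.mem_map, Finset.mem_toList, Finset.mem_univ,
    true_and, Prod.mk.injEq]
  constructor
  · rintro ⟨t, x, hx, -⟩
    exact ⟨x, hx⟩
  · rintro ⟨x, rfl⟩
    exact ⟨_, x, rfl, rfl⟩

theorem entry_networkMap (hid : Function.Injective ident) (x : V) :
    (networkMap ident label level depth E K).entry (ident x) =
      (ident (label x), level x, depth x) := by
  have h := (listed_networkMap label level depth E K (ident x)).2 ⟨x, rfl⟩
  rw [GlobalMap.entry, dif_pos h]
  have h2 := h.choose_spec
  generalize h.choose = t at h2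
  simp only [networkMap, List.mem_map, Finset.mem_toList, Finset.mem_univ, true_and,
    Prod.mk.injEq] at h2
  obtain ⟨y, hy, rfl⟩ := h2
  rw [hid hy]

end networkMap

/-- The edges that have to be listed on a map when the pairs in `K` are known. -/
def IsMapped (G : SimpleGraph V) (level : V → ℕ) (K : Finset (V × V)) (p : V × V) : Prop :=
  G.Adj p.1 p.2 ∧ (level p.1 ≠ 0 ∨ level p.2 ≠ 0 ∨ p ∈ K)

/-- Without a copy of the pattern, the vertices accept a suitable map of the network, provided
that the vertices of level `0` find all the edges in the certificates of their neighbours. -/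
theorem nodeAccepts_networkMap [Fintype V] {G : SimpleGraph V} {H : SimpleGraph W} {ind : Prop}
    {k : ℕ} (hk : 2 ≤ k) {ident : V → ℕ} (hid : Function.Injective ident)
    {label : V → V} {level depth : V → ℕ} {E K : Finset (V × V)}
    (hE : ∀ p, p ∈ E ↔ IsMapped G level K p)
    (hlab : ∀ x y, G.Adj x y → level x + 2 ≤ k → label y = label x)
    (hlev : ∀ x y, G.Adj x y → level y ≤ level x + 1)
    (hpred : ∀ x, 0 < level x → level x < k → ∃ y, G.Adj x y ∧ level y + 1 = level x)
    (hdep0 : ∀ x, depth x = 0 → label x = x)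
    (hdep : ∀ x, 0 < depth x → ∃ y, G.Adj x y ∧ depth y < depth x ∧ label y = label x ∧
        (level x + 2 ≤ k ∨ level y + 2 ≤ k))
    {T : SimpleGraph V} (hT : T.Connected) (hTG : T ≤ G) (hTK : ∀ x y, T.Adj x y → (x, y) ∈ K)
    (hrep : HasRepresentatives k H ind G (fun x => ident (label x)) level fun x y => (x, y) ∈ K)
    (hno : ∀ f : W → V, ¬ IsCopyOn H ind G.Adj Set.univ f)
    {N : V → ℕ → Set (ℕ × ℕ)}
    (hN : ∀ x u, ∀ i < k, G.edist x u ≤ i → level u = 0 →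
      N x (ident u) = {p | ∃ y z, G.Adj y z ∧ p = (ident y, ident z)}) (x : V) :
    NodeAccepts k H ind (networkMap ident label level depth E K) (ident x)
      (ident '' {y | G.Adj x y}) {a | ∃ u, ident u = a ∧ ∃ i < k, G.edist x u ≤ i} (N x) := by
  have hlisted := listed_networkMap (ident := ident) label level depth E K
  have hentry := entry_networkMap label level depth E K hid
  have hedges : ∀ x y, (ident x, ident y) ∈ (networkMap ident label level depth E K).edges ↔
      (x, y) ∈ E := fun x y => mem_identPairs hid
  have hknown : ∀ x y, (ident x, ident y) ∈ (networkMap ident label level depth E K).known ↔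
      (x, y) ∈ K := fun x y => mem_identPairs hid
  have hedge' : ∀ p ∈ (networkMap ident label level depth E K).edges,
      ∃ x y, (x, y) ∈ E ∧ p = (ident x, ident y) := fun p hp => exists_of_mem_identPairs hp
  generalize networkMap ident label level depth E K = g at *
  have hgl : ∀ x, g.label (ident x) = ident (label x) := fun x => by
    rw [GlobalMap.label, hentry]
  have hgv : ∀ x, g.level (ident x) = level x := fun x => by rw [GlobalMap.level, hentry]
  have hgd : ∀ x, g.depth (ident x) = depth x := fun x => by rw [GlobalMap.depth, hentry]
  have hrow : ∀ x, level x = 0 → ∀ y z, (ident y, ident z) ∈ N x (ident x) ↔ G.Adj y z := by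
    intro x hx y z
    rw [hN x x 0 (by omega) (by simp) hx]
    constructor
    · rintro ⟨y', z', h, heq⟩
      simp only [Prod.mk.injEq] at heq
      rwa [hid heq.1, hid heq.2]
    · exact fun h => ⟨y, z, h, rfl⟩
  have hcorrect : g.IsCorrect k G ident :=
    { listed_iff := hlisted
      edge_sound := fun x y h => ((hE _).1 ((hedges x y).1 h)).1
      edge_complete := fun x y hxy h => by
        rw [hedges, hE]
        rw [hgv, hgv, hknown] at h
        exact ⟨hxy, h⟩
      label_eq := fun x y hxy h => by
        rw [hgv] at h
        rw [hgl, hgl, hlab x y hxy h]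
      level_le := fun x y hxy => by
        rw [hgv, hgv]
        exact hlev x y hxy }
  have hmap : g.level (ident x) = 0 → g.IsCorrectMapAt G ident x (N x (ident x)) := by
    intro hx y z _ _
    rw [hgv] at hx
    exact hrow x hx y z
  refine ⟨(hlisted _).2 ⟨x, rfl⟩, ?_, ?_, ?_, ?_, ?_, ?_, ?_, ?_, ?_, ?_, ?_, ?_⟩
  · intro a ha
    obtain ⟨y, rfl⟩ := (hlisted a).1 ha
    clear ha hmap
    obtain ⟨p⟩ := hT.preconnected x y
    induction p with
    | nil => exact Relation.ReflTransGen.refl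
    | cons h p ih =>
      refine Relation.ReflTransGen.head ?_ ih
      rw [hedges, hE]
      exact ⟨hTG h, Or.inr (Or.inr (hTK _ _ h))⟩
  · intro b hb
    obtain ⟨y, z, hyz, heq⟩ := hedge' _ hb
    simp only [Prod.mk.injEq] at heq
    rw [hid heq.1, heq.2]
    exact ⟨z, ((hE _).1 hyz).1, rfl⟩
  · rintro _ ⟨y, hy, rfl⟩ h
    exact hcorrect.edge_complete x y hy h
  · rintro _ ⟨y, hy, rfl⟩ h
    exact hcorrect.label_eq x y hy h
  · rintro _ ⟨y, hy, rfl⟩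
    exact hcorrect.level_le x y hy
  · rw [hgv]
    intro h0 hxk
    obtain ⟨y, hy, h⟩ := hpred x h0 hxk
    exact ⟨_, ⟨y, hy, rfl⟩, by rw [hgv]; exact h⟩
  · rw [hgd, hgl]
    intro h
    rw [hdep0 x h]
  · rw [hgd, hgl, hgv]
    intro h
    obtain ⟨y, hy, h1, h2, h3⟩ := hdep x h
    refine ⟨_, ⟨y, hy, rfl⟩, ?_⟩
    rw [hgd, hgl, hgv, h2]
    exact ⟨h1, rfl, h3⟩
  · rintro _ ⟨u, rfl, i, hi, hu⟩ _ ⟨v, rfl, j, hj, hv⟩ hu0 hv0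
    rw [hgv] at hu0 hv0
    rw [hN x u i hi hu hu0, hN x v j hj hv hv0]
  · intro h b
    rw [hgv] at h
    constructor
    · rw [hN x x 0 (by omega) (by simp) h]
      rintro ⟨y, z, hyz, heq⟩
      simp only [Prod.mk.injEq] at heq
      rw [hid heq.1, heq.2]
      exact ⟨z, hyz, rfl⟩
    · rintro ⟨y, hy, rfl⟩
      exact (hrow x h x y).2 hy
  · rintro ⟨φ, h1, h2, h3⟩
    choose ψ hψ using fun a => (hlisted _).1 (h1 a)
    obtain rfl : (fun a => ident (ψ a)) = φ := funext hψ
    refine hno ψ ⟨fun a _ b _ hab => h3.1 trivial trivial (congrArg ident hab),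
      fun a _ b _ hab => ?_⟩
    exact (Respects.congr (hcorrect.adjacent_iff hk hmap (h2 a b hab))).1
      (h3.2 a trivial b trivial hab)
  · intro hx j hj S R c hc hcx φ hφ hroot
    obtain ⟨c, rfl⟩ := (hlisted c).1 hc
    choose ψ hψ using fun a => (hlisted _).1 (hφ a)
    obtain rfl : (fun a => ident (ψ a)) = φ := funext hψ
    have hiff : ∀ ψ, IsRootedCopy H ind (g.Adjacent (ident x) (N x (ident x))) g.label g.level j S R
        (ident c) (fun a => ident (ψ a)) ↔ IsRootedCopy H ind G.Adj
        (fun x => ident (label x)) level j S R c ψ := by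
      intro ψ
      rw [hcorrect.isRootedCopy_iff hid hk hx (hmap hx) hcx]
      simp only [hgl, hgv]
    rw [hiff] at hroot
    rw [hgv] at hx
    rw [hgl, hgl] at hcx
    obtain ⟨ψ', h1, h2⟩ := hrep x hx j hj S R c hcx ψ hroot
    refine ⟨fun a => ident (ψ' a), fun a => (hlisted _).2 ⟨_, rfl⟩, (hiff ψ').2 h1,
      fun a ha b hb hab => Or.inr (Or.inr (Or.inr ?_))⟩
    exact (hknown _ _).2 (h2 a ha b hb hab)

end Completeness

/-! ### The size of the certificates -/

section Size

variable {V W : Type*}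

/-- The square root of `n`, rounded up. -/
def rootCeil (n : ℕ) : ℕ := n.sqrt + 1

theorem le_rootCeil_mul_self (n : ℕ) : n ≤ rootCeil n * rootCeil n :=
  (Nat.lt_succ_sqrt n).le

/-- The constant in the size of the certificates, for patterns with at most `m` vertices. -/
def sizeConstant (k c m : ℕ) : ℕ := (10 + 2 * (k * 4 ^ m * m ^ 2)) * (8 * (c + 1) + 8 * k + 5) + 4

/-- The size of the certificates. -/
def certificateSize (k c m n : ℕ) : ℕ :=
  sizeConstant k c m * (n * rootCeil n * n.size ^ 2)

open Classical in
theorem exists_spanning_pairs [Fintype V] {G : SimpleGraph V} (hG : G.Connected) :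
    ∃ T : SimpleGraph V, T.Connected ∧ T ≤ G ∧
      ∃ K : Finset (V × V), K.card ≤ 2 * Fintype.card V ∧ ∀ x y, T.Adj x y → (x, y) ∈ K := by
  obtain ⟨T, hTG, hT⟩ := hG.exists_isTree_le
  refine ⟨T, hT.connected, hTG, Finset.univ.filter fun p => T.Adj p.1 p.2, ?_, by simp⟩
  rw [Finset.card_filter, Fintype.sum_prod_type]
  have h1 := T.sum_degrees_eq_twice_card_edges
  have h2 := hT.card_edgeFinset
  have h3 : ∀ x, (∑ y, if T.Adj x y then 1 else 0) = T.degree x := by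
    intro x
    rw [← Finset.card_filter, ← SimpleGraph.card_neighborFinset_eq_degree,
      SimpleGraph.neighborFinset_eq_filter]
  simp only [h3]
  omega

open Classical in
theorem card_isMapped_le [Fintype V] (G : SimpleGraph V) (level : V → ℕ) (K : Finset (V × V))
    (d : ℕ) (hd : ∀ x, level x ≠ 0 → G.degree x ≤ d) :
    (Finset.univ.filter (IsMapped G level K)).card ≤ 2 * (Fintype.card V * d) + K.card := by
  have hlow : ∑ x, (if level x ≠ 0 then G.degree x else 0) ≤ Fintype.card V * d := by
    rw [← smul_eq_mul, ← Finset.card_univ]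
    refine Finset.sum_le_card_nsmul _ _ _ fun x _ => ?_
    split_ifs with h
    · exact hd x h
    · exact Nat.zero_le d
  have hdeg : ∀ x, (∑ y, if G.Adj x y then 1 else 0) = G.degree x := by
    intro x
    rw [← Finset.card_filter, ← SimpleGraph.card_neighborFinset_eq_degree,
      SimpleGraph.neighborFinset_eq_filter]
  have hfst : (Finset.univ.filter fun p : V × V => level p.1 ≠ 0 ∧ G.Adj p.1 p.2).card ≤
      Fintype.card V * d := by
    rw [Finset.card_filter, Fintype.sum_prod_type]
    refine le_of_eq_of_le (Finset.sum_congr rfl fun x _ => ?_) hlow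
    by_cases h : level x = 0 <;> simp [h, ← hdeg]
  have hsnd : (Finset.univ.filter fun p : V × V => level p.2 ≠ 0 ∧ G.Adj p.2 p.1).card ≤
      Fintype.card V * d := by
    rw [Finset.card_filter, Fintype.sum_prod_type_right]
    refine le_of_eq_of_le (Finset.sum_congr rfl fun x _ => ?_) hlow
    by_cases h : level x = 0 <;> simp [h, ← hdeg]
  have hsub : Finset.univ.filter (IsMapped G level K) ⊆
      ((Finset.univ.filter fun p : V × V => level p.1 ≠ 0 ∧ G.Adj p.1 p.2) ∪
      (Finset.univ.filter fun p : V × V => level p.2 ≠ 0 ∧ G.Adj p.2 p.1)) ∪ K := by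
    intro p hp
    obtain ⟨h1, h2⟩ := (Finset.mem_filter.1 hp).2
    simp only [Finset.mem_union, Finset.mem_filter, Finset.mem_univ, true_and]
    rcases h2 with h | h | h
    · exact Or.inl (Or.inl ⟨h, h1⟩)
    · exact Or.inl (Or.inr ⟨h, h1.symm⟩)
    · exact Or.inr h
  have h1 := Finset.card_le_card hsub
  have h2 := Finset.card_union_le ((Finset.univ.filter fun p : V × V => level p.1 ≠ 0 ∧
    G.Adj p.1 p.2) ∪ (Finset.univ.filter fun p : V × V => level p.2 ≠ 0 ∧ G.Adj p.2 p.1)) K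
  have h3 := Finset.card_union_le (Finset.univ.filter fun p : V × V => level p.1 ≠ 0 ∧
    G.Adj p.1 p.2) (Finset.univ.filter fun p : V × V => level p.2 ≠ 0 ∧ G.Adj p.2 p.1)
  omega

theorem size_arithmetic {n Q σ X c k κ v e K l : ℕ} (hn : 0 < n) (hQ : 0 < Q) (hσ : 0 < σ)
    (hv : v = n) (he : e ≤ 2 * (n * (Q * (2 * σ))) + K) (hK : K ≤ 2 * n + n * κ)
    (hl : l ≤ Q * n) (hX : X ≤ (v + e + K + l) * (8 * ((c + 1) * σ + k) + 5) + 4) :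
    X ≤ ((10 + 2 * κ) * (8 * (c + 1) + 8 * k + 5) + 4) * (n * Q * σ ^ 2) := by
  have hQσ : 1 ≤ Q * σ := Nat.mul_pos hQ hσ
  have h1 : n ≤ n * Q * σ := by
    rw [mul_assoc]
    exact Nat.le_mul_of_pos_right n hQσ
  have h2 : Q * n ≤ n * Q * σ := by
    rw [mul_comm Q n]
    exact Nat.le_mul_of_pos_right _ hσ
  have h3 : n * κ ≤ (n * Q * σ) * κ := Nat.mul_le_mul_right κ h1
  have hcount : v + e + K + l ≤ (10 + 2 * κ) * (n * Q * σ) := by nlinarith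
  have hB : 8 * ((c + 1) * σ + k) + 5 ≤ (8 * (c + 1) + 8 * k + 5) * σ := by nlinarith
  have hpos : 0 < n * Q * σ ^ 2 := by positivity
  calc X ≤ (v + e + K + l) * (8 * ((c + 1) * σ + k) + 5) + 4 := hX
    _ ≤ ((10 + 2 * κ) * (n * Q * σ)) * ((8 * (c + 1) + 8 * k + 5) * σ) + 4 * (n * Q * σ ^ 2) :=
        Nat.add_le_add (Nat.mul_le_mul hcount hB) (by omega)
    _ = _ := by ring

/-- Without a copy of the pattern, there are small certificates that all the vertices accept. -/
theorem exists_accepted_certificates [Fintype V] [Fintype W] {G : SimpleGraph V}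
    {H : SimpleGraph W} {ind : Prop} {k c m : ℕ} (hk : 2 ≤ k) (hW : Fintype.card W ≤ m)
    (hG : G.Connected) {ident : V → ℕ} (hid : IsIdentAssignment c ident)
    (hno : ∀ f : W → V, ¬ IsCopyOn H ind G.Adj Set.univ f) :
    ∃ cert : V → List Bool,
      (∀ x, (cert x).length ≤ certificateSize k c m (Fintype.card V)) ∧
      ∀ x, (localView G ident cert k x).Accepts k H ind := by
  classical
  have : Nonempty V := hG.nonempty
  obtain ⟨hinj, hsize⟩ := hid
  set n := Fintype.card V with hn
  set σ := n.size with hσ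
  set Q := rootCeil n with hQ
  have hnpos : 0 < n := Fintype.card_pos
  have hσpos : 0 < σ := Nat.size_pos.2 hnpos
  have hQpos : 0 < Q := Nat.succ_pos _
  have hnσ : n < 2 ^ σ := Nat.lt_size_self n
  have hnQ : n * Q < 2 ^ (2 * σ) := by
    have hQσ : Q ≤ 2 ^ σ := (Nat.succ_le_succ (Nat.sqrt_le_self n)).trans hnσ
    rw [two_mul, pow_add]
    exact (Nat.mul_le_mul_left n hQσ).trans_lt (Nat.mul_lt_mul_of_pos_right hnσ (by positivity))
  obtain ⟨χ, hχ⟩ := exists_coloring_seeing_all Q (2 * σ) hnQ hQpos fun x => G.neighborFinset x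
  obtain ⟨κ, hκ⟩ := exists_small_classes V Q (le_rootCeil_mul_self n)
  obtain ⟨label, level, depth, hlev0, hlevk, hdepn, hlab, hlev, hpred, hdep0, hdep⟩ :=
    exists_labelling hk G {x | Q * (2 * σ) ≤ G.degree x}
  obtain ⟨K₁, hK₁, hrep⟩ := exists_hasRepresentatives k H ind G (fun x => ident (label x)) level
  obtain ⟨T, hT, hTG, K₂, hK₂, hTK⟩ := exists_spanning_pairs hG
  set K := K₂ ∪ K₁ with hK
  set E := Finset.univ.filter (IsMapped G level K) with hE
  have hrep' : HasRepresentatives k H ind G (fun x => ident (label x)) level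
      fun x y => (x, y) ∈ K := by
    intro x hx j hj S R c hc φ hφ
    obtain ⟨φ', h1, h2⟩ := hrep x hx j hj S R c hc φ hφ
    exact ⟨φ', h1, fun a ha b hb hab => Finset.mem_union_right _ (h2 a ha b hb hab)⟩
  let P : V → Finset (V × V) := fun x =>
    Finset.univ.filter fun p => G.Adj p.1 p.2 ∧ κ p.1 = χ x
  let g := networkMap ident label level depth E K
  let cert : V → List Bool := fun x => certificateCode (g, identPairs ident (P x))
  refine ⟨cert, fun x => ?_, fun x => ?_⟩
  · have hB : ∀ x, (ident x).size ≤ (c + 1) * σ + k := fun x =>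
      (hsize x).trans (by rw [add_mul]; omega)
    have hpairs : ∀ (E : Finset (V × V)), ∀ t ∈ identPairs ident E,
        t.1.size ≤ (c + 1) * σ + k ∧ t.2.size ≤ (c + 1) * σ + k := by
      intro E t ht
      obtain ⟨x, y, -, rfl⟩ := exists_of_mem_identPairs ht
      exact ⟨hB x, hB y⟩
    have hlen := length_certificateCode_le g (identPairs ident (P x)) ((c + 1) * σ + k) ?_
      (hpairs E) (hpairs K) (hpairs (P x))
    · rw [show g.known.length = K.card from length_identPairs ident K] at hlen
      refine size_arithmetic (K := K.card) hnpos hQpos hσpos ?_ ?_ ?_ ?_ hlen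
      · simp [g, networkMap, hn]
      · simp only [g, networkMap, length_identPairs]
        refine card_isMapped_le G level K _ fun x hx => ?_
        rw [Ne, hlev0] at hx
        exact (not_le.1 hx).le
      · refine (Finset.card_union_le _ _).trans (Nat.add_le_add hK₂ (hK₁.trans ?_))
        gcongr
        norm_num
      · rw [length_identPairs]
        have hsub : P x ⊆ (Finset.univ.filter fun y => κ y = χ x) ×ˢ Finset.univ := by
          intro p hp
          simpa using (Finset.mem_filter.1 hp).2.2
        refine (Finset.card_le_card hsub).trans ?_
        rw [Finset.card_product, Finset.card_univ]
        exact Nat.mul_le_mul_right _ (hκ (χ x) _ (by simp))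
    · intro t ht
      simp only [g, networkMap, List.mem_map, Finset.mem_toList, Finset.mem_univ, true_and] at ht
      obtain ⟨y, rfl⟩ := ht
      refine ⟨hB y, hB _, ?_, ?_⟩
      · have : (level y).size ≤ k := Nat.size_le.2 ((hlevk y).trans_lt Nat.lt_two_pow_self)
        simp only
        omega
      · have : (depth y).size ≤ σ := Nat.size_le_size (hdepn y).le
        simp only [add_mul]
        omega
  · have hdec : ∀ y, decodeCertificate (cert y) = (g, identPairs ident (P y)) := fun y =>
      decodeCertificate_code _
    refine ⟨g, ?_, ?_⟩
    · rintro b ct ⟨y, -, h⟩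
      simp only [Prod.mk.injEq] at h
      rw [h.2, hdec]
    · rw [neighbors_localView cert hinj (by omega : 0 < k)]
      simp only [reaches_localView_iff cert hinj]
      refine nodeAccepts_networkMap hk hinj (fun p => Finset.mem_filter.trans (and_iff_right (Finset.mem_univ p))) hlab hlev hpred hdep0 hdep hT
        hTG (fun x y h => Finset.mem_union_left _ (hTK x y h)) hrep' hno
        (N := fun x => (localView G ident cert k x).pieces) ?_ x
      intro x u i hi hu hu0
      rw [pieces_localView cert hinj hu hi]
      ext p
      constructor
      · rintro ⟨y, hy, hp⟩
        rw [hdec] at hp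
        obtain ⟨a, b, hab, rfl⟩ := exists_of_mem_identPairs hp
        exact ⟨a, b, (Finset.mem_filter.1 hab).2.1, rfl⟩
      · rintro ⟨a, b, hab, rfl⟩
        obtain ⟨y, hy, hχy⟩ := hχ u (by
          rw [SimpleGraph.card_neighborFinset_eq_degree]
          exact (hlev0 u).1 hu0) (κ a)
        refine ⟨y, (G.mem_neighborFinset u y).1 hy, ?_⟩
        rw [hdec]
        exact (mem_identPairs hinj).2 (Finset.mem_filter.2 ⟨Finset.mem_univ _, hab, hχy.symm⟩)

theorem certificateSize_isBigO (k c m : ℕ) :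
    (fun n : ℕ => (certificateSize k c m n : ℝ)) =O[Filter.atTop]
      (fun n : ℕ => (n : ℝ) ^ (3 / 2 : ℝ) * (Real.log n) ^ 2) := by
  refine Asymptotics.IsBigO.of_bound (sizeConstant k c m * 18) ?_
  filter_upwards [Filter.eventually_ge_atTop 3] with n hn
  have hn3 : (3 : ℝ) ≤ n := by exact_mod_cast hn
  have hn0 : (0 : ℝ) < n := by linarith
  have hlog : 1 ≤ Real.log n := by
    rw [Real.le_log_iff_exp_le hn0]
    exact Real.exp_one_lt_three.le.trans hn3
  have hsize : (n.size : ℝ) ≤ 3 * Real.log n := by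
    have h1 : 0 < n.size := Nat.size_pos.2 (by omega)
    have h2 : 2 ^ (n.size - 1) ≤ n := Nat.lt_size.1 (by omega)
    have h3 : ((n.size - 1 : ℕ) : ℝ) * Real.log 2 ≤ Real.log n := by
      rw [← Real.log_pow]
      exact Real.log_le_log (by positivity) (by exact_mod_cast h2)
    rw [Nat.cast_sub h1, Nat.cast_one] at h3
    have h4 := Real.log_two_gt_d9
    have h5 : (1 : ℝ) ≤ n.size := by exact_mod_cast h1
    nlinarith
  have hroot : (rootCeil n : ℝ) ≤ 2 * Real.sqrt n := by
    have h1 : (n.sqrt : ℝ) ≤ Real.sqrt n := Real.nat_sqrt_le_real_sqrt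
    have h2 : 1 ≤ Real.sqrt n := Real.one_le_sqrt.2 (by linarith)
    rw [rootCeil, Nat.cast_add, Nat.cast_one]
    linarith
  have hpow : (n : ℝ) ^ (3 / 2 : ℝ) = n * Real.sqrt n := by
    rw [Real.sqrt_eq_rpow, show (3 / 2 : ℝ) = 1 + 1 / 2 by norm_num, Real.rpow_add hn0,
      Real.rpow_one]
  rw [Real.norm_of_nonneg (by positivity), Real.norm_of_nonneg (by positivity), hpow,
    certificateSize]
  push_cast
  calc (sizeConstant k c m : ℝ) * (n * rootCeil n * (n.size : ℝ) ^ 2)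
      ≤ sizeConstant k c m * (n * (2 * Real.sqrt n) * (3 * Real.log n) ^ 2) := by gcongr
    _ = _ := by ring

end Size

theorem isIndContained_iff {V W : Type*} {G : SimpleGraph V} {H : SimpleGraph W} :
    H.IsIndContained G ↔ ∃ f : W → V, IsCopyOn H True G.Adj Set.univ f := by
  constructor
  · rintro ⟨f⟩
    exact ⟨f, f.injective.injOn, fun _ _ _ _ _ => ⟨f.map_rel_iff.2, fun _ => f.map_rel_iff.1⟩⟩
  · rintro ⟨f, hf, hadj⟩
    refine ⟨⟨⟨f, Set.injOn_univ.1 hf⟩, fun {a b} => ?_⟩⟩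
    by_cases hab : a = b
    · subst hab
      simp
    · exact ⟨(hadj a trivial b trivial hab).2 trivial, (hadj a trivial b trivial hab).1⟩

theorem isContained_iff {V W : Type*} {G : SimpleGraph V} {H : SimpleGraph W} :
    H.IsContained G ↔ ∃ f : W → V, IsCopyOn H False G.Adj Set.univ f := by
  constructor
  · rintro ⟨f⟩
    exact ⟨f, f.injective.injOn, fun _ _ _ _ _ => ⟨f.toHom.map_rel, False.elim⟩⟩
  · rintro ⟨f, hf, hadj⟩
    exact ⟨⟨⟨f, fun {a b} h => (hadj a trivial b trivial h.ne).1 h⟩, Set.injOn_univ.1 hf⟩⟩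

open Classical in
theorem hasLocalCertification_of_isCopyOn {W : Type v} [Fintype W] (H : SimpleGraph W) (ind : Prop)
    {k : ℕ} (hk : 2 ≤ k) (c : ℕ) (hW : Fintype.card W ≤ 4 * k - 1)
    (P : ∀ (V : Type u) [Fintype V], SimpleGraph V → Prop)
    (hP : ∀ (V : Type u) [Fintype V] (G : SimpleGraph V),
      P V G ↔ ¬ ∃ f : W → V, IsCopyOn H ind G.Adj Set.univ f) :
    HasLocalCertification.{u} c k (certificateSize k c (4 * k - 1)) P := by
  refine ⟨fun w => decide (w.Accepts k H ind), fun V _ G hG ident hid => ⟨fun h => ?_, fun h => ?_⟩⟩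
  · rw [hP, not_exists] at h
    obtain ⟨cert, h1, h2⟩ := exists_accepted_certificates hk hW hG hid h
    exact ⟨cert, h1, fun x => decide_eq_true (h2 x)⟩
  · intro cert
    by_contra! hcon
    rw [hP, not_not] at h
    obtain ⟨f, hf⟩ := h
    refine no_copy_of_accepts hk (by omega) hG hid.1 cert (fun x => ?_) f hf
    simpa using hcon x

theorem mainTheorem4 (k : ℕ) (hk : 2 ≤ k) (c : ℕ) :
    ∃ s : ℕ → ℕ,
      (fun n : ℕ => (s n : ℝ)) =O[Filter.atTop]
        (fun n : ℕ => (n : ℝ) ^ (3 / 2 : ℝ) * (Real.log n) ^ 2) ∧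
      ∀ (W : Type v) [Fintype W] (H : SimpleGraph W), Fintype.card W ≤ 4 * k - 1 →
        HasLocalCertification.{u} c k s (fun _ _ G => ¬ H.IsIndContained G) ∧
        HasLocalCertification.{u} c k s (fun _ _ G => ¬ H.IsContained G) :=
  ⟨certificateSize k c (4 * k - 1), certificateSize_isBigO k c (4 * k - 1), fun _ _ H hW =>
    ⟨hasLocalCertification_of_isCopyOn H True hk c hW _ fun _ _ _ => not_congr isIndContained_iff,
      hasLocalCertification_of_isCopyOn H False hk c hW _ fun _ _ _ => not_congr isContained_iff⟩⟩
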